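/- Let $q,s\in\mathbb{C}$. For $u\in\mathbb{C}$ with $su\neq 1$ and $g\in\mathbb{Z}_{\ge 0}$ put $$w_u(g,0;g,0)=\frac{1-sq^gu}{1-su},\quad w_u(g+1,0;g,1)=\frac{(1-s^2q^g)u}{1-su},\quad w_u(g,1;g,1)=\frac{u-sq^g}{1-su},\quad w_u(g,1;g+1,0)=\frac{1-q^{g+1}}{1-su},$$ and let all other $w_u(i_1,j_1;i_2,j_2)$ be zero; here $i_1$, $j_1$ are the numbers of arrows entering a vertex from below and from the left, and $i_2$, $j_2$ the numbers of arrows leaving it upwards and to the right. The weight of a collection of up-right paths on $\mathbb{Z}_{\ge 0}\times\{1,\dots,n\}$ (recorded by the numbers of paths along the edges) is the product over all vertices $(x,y)$ of $w_{u_y}$ of the arrow numbers at $(x,y)$, where $u_y$ is attached to the row $y$. Let $\mathrm{Sign}_n^+$ be the set of integer sequences $\nu_1\ge\dots\ge\nu_n\ge 0$. * For $\mu\in\mathrm{Sign}^+_M$, $F_\mu(u_1,\dots,u_M)$ is the sum of the weights of all collections of $M$ up-right paths in $M$ rows such that one path enters each row from the left at column $0$, no path enters from below, and the paths leave the top row upwards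 in the columns $\mu_1,\dots,\mu_M$. * For $\nu\in\mathrm{Sign}^+_n$, $G_\nu(v_1,\dots,v_N)$ is the sum of the weights of all collections of $n$ up-right paths in $N$ rows such that all $n$ paths enter from below in column $0$, no path enters from the left, and the paths leave the top row upwards in the columns $\nu_1,\dots,\nu_n$. Both sums are finite. Write $(z;q)_n=\prod_{i=0}^{n-1}(1-zq^i)$, and let a permutation $\sigma$ act on functions of several variables by permuting the variables. 1. Let $M\ge 0$, $\mu\in\mathrm{Sign}_M^+$, and $u_1,\dots,u_M\in\mathbb{C}$ with $su_i\ne 1$ for all $i$. Then $$F_\mu(u_1,\dots,u_M)=\frac{(1-q)^M}{\prod_{i=1}^M(1-su_i)}\sum_{\sigma\in\mathfrak{S}_M}\sigma\left(\prod_{1\le\alpha<\beta\le M}\frac{u_\alpha-qu_\beta}{u_\alpha-u_\beta}\prod_{i=1}^M\left(\frac{u_i-s}{1-su_i}\right)^{\mu_i}\right)$$ if the $u_i$ are pairwise distinct. For arbitrary such $u_i$ the formula holds in the sense that $F_\mu(u_1,\dots,u_M)$ is the limit of the right-hand side at $(w_1,\dots,w_M)$ as $(w_1,\dots,w_M)\to(u_1,\dots,u_M)$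 through points with pairwise distinct coordinates. 2. Let $n\ge 0$, let $\nu\in\mathrm{Sign}_n^+$ have exactly $k$ zero coordinates, let $N\ge 0$, and let $v_1,\dots,v_N\in\mathbb{C}$ with $sv_j\neq 1$ for all $j$. If $N\ge n-k$, $(q;q)_{N-n+k}\ne 0$ and $(s^2;q)_k\neq 0$, then $$G_\nu(v_1,\dots,v_N)=\frac{(s^2;q)_n}{(q;q)_{N-n+k}(s^2;q)_k}\frac{(1-q)^N}{\prod_{j=1}^N(1-sv_j)}\sum_{\sigma\in\mathfrak{S}_N}\sigma\left(\prod_{1\le\alpha<\beta\le N}\frac{v_\alpha-qv_\beta}{v_\alpha-v_\beta}\prod_{j=1}^{n-k}\left(\frac{v_j-s}{1-sv_j}\right)^{\nu_j}\prod_{i=1}^{n-k}\frac{v_i}{v_i-s}\prod_{j=n-k+1}^N(1-sq^kv_j)\right)$$ if the $v_j$ are pairwise distinct and different from $s$. For arbitrary such $v_j$ (with $sv_j\neq 1$) it holds in the sense that $G_\nu(v_1,\dots,v_N)$ is the limit of the right-hand side at $(w_1,\dots,w_N)$ as $(w_1,\dots,w_N)\to(v_1,\dots,v_N)$ through points with pairwise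 distinct coordinates different from $s$. If $N<n-k$, then $G_\nu(v_1,\dots,v_N)=0$. -/

import Mathlib

open Filter Topology

noncomputable section

namespace HigherSpin

/-- The q-Pochhammer symbol `(z; q)_n = ∏_{i=0}^{n-1} (1 - z q^i)`, for `n ≥ 0`. -/
def qPoch (z q : ℂ) (n : ℕ) : ℂ := ∏ i ∈ Finset.range n, (1 - z * q ^ i)

/-- The vertex weight `w_u(i₁, j₁; i₂, j₂)` of the higher spin six vertex model: `i₁` (resp. `j₁`)
arrows enter from below (resp. from the left), `i₂` (resp. `j₂`) arrows leave upwards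
(resp. to the right).  All the weights not listed are zero. -/
def vertexWeight (q s u : ℂ) : ℕ → ℕ → ℕ → ℕ → ℂ
  | i₁, 0, i₂, 0 => if i₁ = i₂ then (1 - s * q ^ i₁ * u) / (1 - s * u) else 0
  | i₁, 0, i₂, 1 => if i₁ = i₂ + 1 then (1 - s ^ 2 * q ^ i₂) * u / (1 - s * u) else 0
  | i₁, 1, i₂, 1 => if i₁ = i₂ then (u - s * q ^ i₁) / (1 - s * u) else 0
  | i₁, 1, i₂, 0 => if i₂ = i₁ + 1 then (1 - q ^ (i₁ + 1)) / (1 - s * u) else 0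
  | _, _, _, _ => 0

/-- The number of coordinates of `lam` that are equal to `x`. -/
def mult {N : ℕ} (lam : Fin N → ℕ) (x : ℕ) : ℕ :=
  (Finset.univ.filter fun i => lam i = x).card

/-- Collections of up-right paths in `n` horizontal rows and in the columns `0, 1, 2, …`, encoded
by their edge multiplicities.  The paths start with the vertical edges entering the lowest row in
the columns `lam i` and with `left` horizontal edges entering every row at column `0`; they end
with the vertical edges leaving the top row in the columns `mu i`. -/
@[ext]
structure PathCollection (left : ℕ) {N m : ℕ} (lam : Fin N → ℕ) (mu : Fin m → ℕ) (n : ℕ) where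
  /-- `vert y x` is the number of arrows on the vertical edge of column `x` just below row `y`
  (just above the top row, for `y = n`). -/
  vert : Fin (n + 1) → ℕ → ℕ
  /-- `horiz y x` is the number of arrows on the horizontal edge `(x - 1, y) → (x, y)`. -/
  horiz : Fin n → ℕ → ℕ
  vert_bottom : ∀ x, vert 0 x = mult lam x
  vert_top : ∀ x, vert (Fin.last n) x = mult mu x
  horiz_left : ∀ y, horiz y 0 = left
  /-- Arrow preservation at the vertex `(x, y)`. -/
  preserve : ∀ y x, vert y.castSucc x + horiz y x = vert y.succ x + horiz y (x + 1)
  /-- No path escapes to the right: every path leaves through the top row. -/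
  horiz_right : ∀ y, ∃ X, ∀ x, X ≤ x → horiz y x = 0

/-- The weight of a path collection: the product of the weights of all the vertices.
(A vertex without arrows has weight `1`, if `1 - s * u y ≠ 0`.) -/
def PathCollection.weight (q s : ℂ) {left N m n : ℕ} {lam : Fin N → ℕ} {mu : Fin m → ℕ}
    (u : Fin n → ℂ) (P : PathCollection left lam mu n) : ℂ :=
  ∏ y : Fin n, ∏ᶠ x : ℕ, vertexWeight q s (u y)
    (P.vert y.castSucc x) (P.horiz y x) (P.vert y.succ x) (P.horiz y (x + 1))

/-- Nothing happens to the right of the largest final position. -/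
theorem PathCollection.eq_zero_of_lt {left N m n : ℕ} {lam : Fin N → ℕ} {mu : Fin m → ℕ} {L : ℕ}
    (hL : ∀ i, mu i ≤ L) (P : PathCollection left lam mu n) {x : ℕ} (hx : L < x) :
    (∀ y, P.vert y x = 0) ∧ ∀ y, P.horiz y x = 0 := by
  have step : ∀ y : Fin n, (∀ x, L < x → P.vert y.succ x = 0) →
      ∀ x, L < x → P.horiz y x = 0 := by
    intro y hy x hx
    obtain ⟨X, hX⟩ := P.horiz_right y
    have key : ∀ d, P.horiz y x ≤ P.horiz y (x + d) := by
      intro d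
      induction d with
      | zero => exact le_rfl
      | succ d ih =>
        have h1 := P.preserve y (x + d)
        have h2 := hy (x + d) (by omega)
        have h3 : x + (d + 1) = x + d + 1 := by omega
        rw [h3]
        omega
    have h4 := key X
    have h5 := hX (x + X) (by omega)
    omega
  have hv : ∀ y, ∀ x, L < x → P.vert y x = 0 := by
    intro y
    induction y using Fin.reverseInduction with
    | last =>
      intro x hx
      rw [P.vert_top, mult, Finset.card_eq_zero, Finset.filter_eq_empty_iff]
      intro i _ h
      have := hL i
      omega
    | cast y ih =>
      intro x hx
      have h1 := P.preserve y x
      have h2 := step y ih (x + 1) (by omega)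
      have h3 := ih x hx
      omega
  exact ⟨fun y => hv y x hx, fun y => step y (hv y.succ) x hx⟩

/-- There are finitely many path collections with given boundary conditions, so that the sums
below are finite sums. -/
instance PathCollection.instFinite {left N m n : ℕ} {lam : Fin N → ℕ} {mu : Fin m → ℕ} :
    Finite (PathCollection left lam mu n) := by
  have hb : ∀ (y : Fin n), (∀ x, ∃ B, ∀ P : PathCollection left lam mu n,
      P.vert y.castSucc x ≤ B) → ∀ x, ∃ B, ∀ P : PathCollection left lam mu n,
      P.horiz y x ≤ B := by
    intro y hy x
    induction x with
    | zero => exact ⟨left, fun P => (P.horiz_left y).le⟩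
    | succ x ih =>
      obtain ⟨B, hB⟩ := ih
      obtain ⟨C, hC⟩ := hy x
      refine ⟨B + C, fun P => ?_⟩
      have h1 := P.preserve y x
      have h2 := hB P
      have h3 := hC P
      omega
  have vb : ∀ (y : Fin (n + 1)) (x : ℕ), ∃ B, ∀ P : PathCollection left lam mu n,
      P.vert y x ≤ B := by
    intro y
    induction y using Fin.induction with
    | zero => exact fun x => ⟨mult lam x, fun P => (P.vert_bottom x).le⟩
    | succ y ih =>
      intro x
      obtain ⟨B, hB⟩ := ih x
      obtain ⟨C, hC⟩ := hb y ih x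
      refine ⟨B + C, fun P => ?_⟩
      have h1 := P.preserve y x
      have h2 := hB P
      have h3 := hC P
      omega
  choose BV hBV using vb
  choose BH hBH using fun y => hb y fun x => ⟨_, hBV y.castSucc x⟩
  obtain ⟨L, hL⟩ : ∃ L, ∀ i, mu i ≤ L :=
    ⟨∑ i, mu i, fun i => Finset.single_le_sum (fun _ _ => Nat.zero_le _) (Finset.mem_univ i)⟩
  let f : PathCollection left lam mu n →
      ((y : Fin (n + 1)) → (x : Fin (L + 1)) → Fin (BV y x + 1)) ×
      ((y : Fin n) → (x : Fin (L + 1)) → Fin (BH y x + 1)) := fun P =>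
    (fun y x => ⟨P.vert y x, Nat.lt_succ_of_le (hBV y x P)⟩,
     fun y x => ⟨P.horiz y x, Nat.lt_succ_of_le (hBH y x P)⟩)
  refine Finite.of_injective f fun P Q h => ?_
  have h1 := congrArg Prod.fst h
  have h2 := congrArg Prod.snd h
  apply PathCollection.ext
  · funext y x
    by_cases hx : L < x
    · rw [(P.eq_zero_of_lt hL hx).1, (Q.eq_zero_of_lt hL hx).1]
    · exact congrArg Fin.val (congrFun (congrFun h1 y) ⟨x, by omega⟩)
  · funext y x
    by_cases hx : L < x
    · rw [(P.eq_zero_of_lt hL hx).2, (Q.eq_zero_of_lt hL hx).2]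
    · exact congrArg Fin.val (congrFun (congrFun h2 y) ⟨x, by omega⟩)

/-- `F_{μ/λ}(u_1, …, u_n)`: the partition function with one path entering every row from the
left. -/
def skewF (q s : ℂ) {N m n : ℕ} (lam : Fin N → ℕ) (mu : Fin m → ℕ) (u : Fin n → ℂ) : ℂ :=
  ∑ᶠ P : PathCollection 1 lam mu n, P.weight q s u

/-- `G_{μ/λ}(u_1, …, u_n)`: the partition function with no paths entering from the left. -/
def skewG (q s : ℂ) {N n : ℕ} (lam mu : Fin N → ℕ) (u : Fin n → ℂ) : ℂ :=
  ∑ᶠ P : PathCollection 0 lam mu n, P.weight q s u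

/-- `F_μ = F_{μ/∅}`. -/
def F (q s : ℂ) {M : ℕ} (mu : Fin M → ℕ) (u : Fin M → ℂ) : ℂ :=
  skewF q s (Fin.elim0 : Fin 0 → ℕ) mu u

/-- `G_ν = G_{ν/(0,…,0)}`. -/
def G (q s : ℂ) {n N : ℕ} (nu : Fin n → ℕ) (v : Fin N → ℂ) : ℂ :=
  skewG q s (fun _ : Fin n => 0) nu v

/-- `∑_σ σ(f)`, where the permutation `σ` acts by permuting the variables. -/
def symmetrize {N : ℕ} (f : (Fin N → ℂ) → ℂ) (u : Fin N → ℂ) : ℂ :=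
  ∑ σ : Equiv.Perm (Fin N), f fun i => u (σ i)

/-- `∏_{α < β} (u_α - q u_β) / (u_α - u_β)`. -/
def crossTerm (q : ℂ) {N : ℕ} (u : Fin N → ℂ) : ℂ :=
  ∏ α : Fin N, ∏ β ∈ Finset.Ioi α, (u α - q * u β) / (u α - u β)

/-- The right-hand side of the symmetrization formula for `F_μ(u_1, …, u_M)`. -/
def symmF (q s : ℂ) {M : ℕ} (mu : Fin M → ℕ) (u : Fin M → ℂ) : ℂ :=
  (1 - q) ^ M / (∏ i, (1 - s * u i)) *
    symmetrize (fun w => crossTerm q w * ∏ i, ((w i - s) / (1 - s * w i)) ^ mu i) u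

/-- The right-hand side of the symmetrization formula for `G_ν(v_1, …, v_N)`, where `k ≤ n` is the
number of zero coordinates of `ν` and `n - k ≤ N`.  (The index `j` starts from `0`, so that the
conditions `j < n - k` and `n - k ≤ j` stand for the first `n - k` and for the other variables.) -/
def symmG (q s : ℂ) {n N : ℕ} (nu : Fin n → ℕ) (k : ℕ) (v : Fin N → ℂ) : ℂ :=
  qPoch (s ^ 2) q n / (qPoch q q (N - (n - k)) * qPoch (s ^ 2) q k) *
    ((1 - q) ^ N / ∏ j, (1 - s * v j)) *
    symmetrize (fun w => crossTerm q w *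
      ∏ j : Fin N, if h : j.val < n - k then
          ((w j - s) / (1 - s * w j)) ^ nu ⟨j.val, lt_of_lt_of_le h (Nat.sub_le n k)⟩ *
            (w j / (w j - s))
        else 1 - s * q ^ k * w j) v

end HigherSpin

end

/-!
The partition functions are computed by the algebraic Bethe ansatz, splitting off the columns of the
lattice one by one from the left.

Let `A(u) = rowOp q s u 0` and `B(u) = rowOp q s u 1` be the operators of a row in which no path,
respectively one path, enters from the left and from which no path leaves to the right.  By the
Yang-Baxter equation the `A(u)` commute, the `B(u)` commute, and
`B(u) A(v) = f(u, v) A(v) B(u) + g(v, u) A(u) B(v)` with `f(u, v) = (u - q v) / (u - v)` and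
`g(v, u) = (1 - q) v / (v - u)` (`rowOp_exchange_aux`); the operator standing first in a product is
the lowest row, and `A(u)` acts trivially on the empty configuration.  Hence a product of row
operators with spectral parameters `u_j`, `j ∈ J`, on all columns expands as a sum over `I ⊆ J` of
products of the `B(u_i)`, `i ∈ I`, on all columns but the first (`rowProd_cons_vacuum`).  The
coefficients are explicit products, among them `∏_{i ∈ I, l ∈ J \ I} f(u_i, u_l)`; adding one row at
a time, this amounts to partial fraction identities for the rational function `∏_l f(v, u_l)` of
`v` (`prod_cross_eq_one_add`, `prod_cross_eq_pow_add`, `prod_cross_mul_prod_eq`).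

The symmetrized sums satisfy the same recursion: if the last `b` variables enter through one common
function only, then the sum over the symmetric group reduces to a sum over subsets, with
`∑_{σ ∈ S_b} σ(∏_{α < β} f(u_α, u_β)) = (q; q)_b / (1 - q)^b`
(`crossSum_append_replicate`).  Induction on the number of columns gives the formula for `F`
(`rowProd_one_pointMass`).  For `G` only the first column is different
(`rowProd_zero_pointMass`).  At coinciding spectral parameters the formulas hold in the limit, since
the partition functions are finite sums of products of continuous vertex weights.
-/

noncomputable section
namespace HigherSpin

/-! ### The cross factor and its partial fraction expansions -/

/-- The factor `(a - q b) / (a - b)` attached to an ordered pair of spectral parameters. -/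
def cross (q a b : ℂ) : ℂ := (a - q * b) / (a - b)

/-- The second coefficient of the exchange relation of the row operators. -/
def exch (q a b : ℂ) : ℂ := (1 - q) * a / (a - b)

theorem qPoch_succ (z q : ℂ) (n : ℕ) : qPoch z q (n + 1) = qPoch z q n * (1 - z * q ^ n) :=
  Finset.prod_range_succ _ _

variable {ι : Type*} [DecidableEq ι]

/-- The induction step shared by the partial fraction expansions: every term of the sum over `K`
is split when a node is added. -/
theorem cross_mul_div_sub (q v x w : ℂ) (hvx : v ≠ x) (hvw : v ≠ w) (hxw : x ≠ w) :
    cross q v w / (v - x) = cross q x w / (v - x) + (1 - q) * w / (v - w) / (w - x) := by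
  have h1 := sub_ne_zero.2 hvx
  have h2 := sub_ne_zero.2 hvw
  have h3 := sub_ne_zero.2 hxw
  have h4 := sub_ne_zero.2 hxw.symm
  unfold cross
  field_simp
  ring

/-- How `∑_{j ∈ K} p_j ∏_{l ∈ K \ j} f(u_j, u_l)` changes when a node is added to `K`. -/
theorem sum_prod_cross_insert (q : ℂ) (u : ι → ℂ) (p : ι → ℂ) {k : ι} {K : Finset ι}
    (hk : k ∉ K) :
    ∑ j ∈ insert k K, p j * ∏ l ∈ (insert k K).erase j, cross q (u j) (u l) =
      p k * ∏ l ∈ K, cross q (u k) (u l) +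
      ∑ j ∈ K, p j * (cross q (u j) (u k) * ∏ l ∈ K.erase j, cross q (u j) (u l)) := by
  rw [Finset.sum_insert hk, Finset.erase_insert hk]
  congr 1
  refine Finset.sum_congr rfl fun j hj => ?_
  have hjk : k ≠ j := by rintro rfl; exact hk hj
  rw [Finset.erase_insert_of_ne hjk,
    Finset.prod_insert (fun h => hk (Finset.mem_of_mem_erase h))]

/-- Partial fractions of `∏_l (v - q u_l) / (v - u_l)` in the variable `v`, normalized by the value
`1` at `v = ∞`. -/
theorem prod_cross_eq_one_add (q : ℂ) {u : ι → ℂ} (hu : Function.Injective u) (K : Finset ι) :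
    ∀ v, (∀ j ∈ K, v ≠ u j) → ∏ l ∈ K, cross q v (u l) =
      1 + ∑ j ∈ K, (1 - q) * u j / (v - u j) * ∏ l ∈ K.erase j, cross q (u j) (u l) := by
  induction K using Finset.induction_on with
  | empty => simp
  | insert k K hk ih =>
    intro v hv
    have hvk := hv k (Finset.mem_insert_self _ _)
    have hvj := fun j hj => hv j (Finset.mem_insert_of_mem (s := K) hj)
    have hkj : ∀ j ∈ K, u k ≠ u j := fun j hj h => hk (hu h ▸ hj)
    rw [sum_prod_cross_insert q u _ hk, Finset.prod_insert hk, ih v hvj, ih (u k) hkj,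
      mul_add, mul_add, Finset.mul_sum, Finset.mul_sum, add_assoc,
      ← Finset.sum_add_distrib, ← add_assoc]
    congr 1
    · have := sub_ne_zero.2 hvk
      unfold cross
      field_simp
      ring
    · refine Finset.sum_congr rfl fun j hj => ?_
      linear_combination ((1 - q) * u j * ∏ l ∈ K.erase j, cross q (u j) (u l)) *
        cross_mul_div_sub q v (u j) (u k) (hvj j hj) hvk (hkj j hj).symm

/-- Partial fractions of `∏_l (v - q u_l) / (v - u_l)` in the variable `v`, normalized by the value
`q ^ |K|` at `v = 0`. -/
theorem prod_cross_eq_pow_add (q : ℂ) {u : ι → ℂ} (hu : Function.Injective u) (K : Finset ι) :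
    ∀ v, (∀ j ∈ K, v ≠ u j) → ∏ l ∈ K, cross q v (u l) =
      q ^ K.card + ∑ j ∈ K, exch q v (u j) * ∏ l ∈ K.erase j, cross q (u j) (u l) := by
  induction K using Finset.induction_on with
  | empty => simp
  | insert k K hk ih =>
    intro v hv
    have hvk := hv k (Finset.mem_insert_self _ _)
    have hvj := fun j hj => hv j (Finset.mem_insert_of_mem (s := K) hj)
    have hkj : ∀ j ∈ K, u k ≠ u j := fun j hj h => hk (hu h ▸ hj)
    rw [sum_prod_cross_insert q u _ hk, Finset.prod_insert hk, ih v hvj, ih (u k) hkj,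
      mul_add, mul_add, Finset.mul_sum, Finset.mul_sum, add_assoc,
      ← Finset.sum_add_distrib, ← add_assoc, Finset.card_insert_of_notMem hk]
    congr 1
    · have := sub_ne_zero.2 hvk
      unfold cross exch
      field_simp
      ring
    · refine Finset.sum_congr rfl fun j hj => ?_
      unfold exch
      linear_combination ((1 - q) * v * ∏ l ∈ K.erase j, cross q (u j) (u l)) *
        cross_mul_div_sub q v (u j) (u k) (hvj j hj) hvk (hkj j hj).symm

/-- Partial fractions of `∏_l (v - q u_l) / (v - u_l)` in the variable `v`, normalized by the value
at `v = 1 / t`; the denominators `1 - t u_l` are cleared. -/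
theorem prod_cross_mul_prod_eq (q t : ℂ) {u : ι → ℂ} (hu : Function.Injective u) (K : Finset ι) :
    ∀ v, (∀ j ∈ K, v ≠ u j) →
      (∏ l ∈ K, cross q v (u l)) * ∏ l ∈ K, (1 - t * u l) =
      ∏ l ∈ K, (1 - t * q * u l) + (1 - t * v) * ∑ j ∈ K,
        ((1 - q) * u j / (v - u j) * ∏ l ∈ K.erase j, (1 - t * u l)) *
          ∏ l ∈ K.erase j, cross q (u j) (u l) := by
  induction K using Finset.induction_on with
  | empty => simp
  | insert k K hk ih =>
    intro v hv
    have hvk := hv k (Finset.mem_insert_self _ _)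
    have hvj := fun j hj => hv j (Finset.mem_insert_of_mem (s := K) hj)
    have hkj : ∀ j ∈ K, u k ≠ u j := fun j hj h => hk (hu h ▸ hj)
    have h1 := ih v hvj
    have h2 := ih (u k) hkj
    have hsplit : ∀ j ∈ K, ∏ l ∈ (insert k K).erase j, (1 - t * u l) =
        (1 - t * u k) * ∏ l ∈ K.erase j, (1 - t * u l) := by
      intro j hj
      have hjk : k ≠ j := by rintro rfl; exact hk hj
      rw [Finset.erase_insert_of_ne hjk,
        Finset.prod_insert (fun h => hk (Finset.mem_of_mem_erase h))]
    rw [sum_prod_cross_insert q u _ hk, Finset.prod_insert hk, Finset.prod_insert hk,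
      Finset.prod_insert hk, Finset.erase_insert hk]
    have hsum : ∑ j ∈ K, (1 - q) * u j / (v - u j) * (∏ l ∈ (insert k K).erase j, (1 - t * u l)) *
          (cross q (u j) (u k) * ∏ l ∈ K.erase j, cross q (u j) (u l)) =
        (1 - t * u k) * (cross q v (u k) * (∑ j ∈ K,
          ((1 - q) * u j / (v - u j) * ∏ l ∈ K.erase j, (1 - t * u l)) *
            ∏ l ∈ K.erase j, cross q (u j) (u l)) - (1 - q) * u k / (v - u k) * ∑ j ∈ K,
          ((1 - q) * u j / (u k - u j) * ∏ l ∈ K.erase j, (1 - t * u l)) *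
            ∏ l ∈ K.erase j, cross q (u j) (u l)) := by
      rw [Finset.mul_sum, Finset.mul_sum, ← Finset.sum_sub_distrib, Finset.mul_sum]
      refine Finset.sum_congr rfl fun j hj => ?_
      rw [hsplit j hj]
      linear_combination (-(1 - t * u k) * (1 - q) * u j *
        (∏ l ∈ K.erase j, (1 - t * u l)) * ∏ l ∈ K.erase j, cross q (u j) (u l)) *
        cross_mul_div_sub q v (u j) (u k) (hvj j hj) hvk (hkj j hj).symm
    rw [hsum]
    have h3 : cross q v (u k) * (1 - t * u k) =
        (1 - t * q * u k) + (1 - t * v) * ((1 - q) * u k / (v - u k)) := by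
      have := sub_ne_zero.2 hvk
      unfold cross
      field_simp
      ring
    linear_combination cross q v (u k) * (1 - t * u k) * h1 -
      (1 - t * v) * ((1 - q) * u k / (v - u k)) * h2 + (∏ l ∈ K, (1 - t * q * u l)) * h3

theorem one_sub_mul_sum_prod_cross (q : ℂ) {u : ι → ℂ} (hu : Function.Injective u)
    (K : Finset ι) :
    (1 - q) * ∑ j ∈ K, ∏ l ∈ K.erase j, cross q (u j) (u l) = 1 - q ^ K.card := by
  obtain ⟨v, hv⟩ := Infinite.exists_notMem_finset (K.image u)
  have hv' : ∀ j ∈ K, v ≠ u j := fun j hj h => hv (h ▸ Finset.mem_image_of_mem u hj)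
  have h1 := prod_cross_eq_one_add q hu K v hv'
  have h2 := prod_cross_eq_pow_add q hu K v hv'
  have h3 : ∑ j ∈ K, exch q v (u j) * ∏ l ∈ K.erase j, cross q (u j) (u l) -
      ∑ j ∈ K, (1 - q) * u j / (v - u j) * ∏ l ∈ K.erase j, cross q (u j) (u l) =
      (1 - q) * ∑ j ∈ K, ∏ l ∈ K.erase j, cross q (u j) (u l) := by
    rw [← Finset.sum_sub_distrib, Finset.mul_sum]
    refine Finset.sum_congr rfl fun j hj => ?_
    have := sub_ne_zero.2 (hv' j hj)
    unfold exch
    field_simp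
  linear_combination -h3 + h1 - h2

/-! ### Symmetrized sums as sums over subsets -/

/-- Sums over pairs `j ∈ I ⊆ J`, reorganized according to `I \ {j}`. -/
theorem sum_powerset_sum_mem {R : Type*} [AddCommMonoid R] (J : Finset ι)
    (h : Finset ι → ι → R) :
    ∑ I ∈ J.powerset, ∑ j ∈ I, h I j =
      ∑ I ∈ J.powerset, ∑ j ∈ J \ I, h (insert j I) j := by
  rw [Finset.sum_sigma', Finset.sum_sigma']
  refine Finset.sum_bij' (fun p _ => ⟨p.1.erase p.2, p.2⟩) (fun p _ => ⟨insert p.2 p.1, p.2⟩)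
    ?_ ?_ ?_ ?_ ?_
  · rintro ⟨I, j⟩ hp
    simp only [Finset.mem_sigma, Finset.mem_powerset, Finset.mem_sdiff] at hp ⊢
    exact ⟨(Finset.erase_subset _ _).trans hp.1, hp.1 hp.2, Finset.notMem_erase _ _⟩
  · rintro ⟨I, j⟩ hp
    simp only [Finset.mem_sigma, Finset.mem_powerset, Finset.mem_sdiff] at hp ⊢
    exact ⟨Finset.insert_subset hp.2.1 hp.1, Finset.mem_insert_self _ _⟩
  · rintro ⟨I, j⟩ hp
    simp only [Finset.mem_sigma] at hp
    simp [Finset.insert_erase hp.2]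
  · rintro ⟨I, j⟩ hp
    simp only [Finset.mem_sigma, Finset.mem_sdiff] at hp
    simp [Finset.erase_insert hp.2.2]
  · rintro ⟨I, j⟩ hp
    simp only [Finset.mem_sigma] at hp
    simp [Finset.insert_erase hp.2]

/-- `crossSum q u [φ₁, …, φ_N] J` is the sum of
`∏_{α < β} f(u_{i_α}, u_{i_β}) ∏_α φ_α(u_{i_α})` over all enumerations `i₁, …, i_N` of the finite
set `J`, where `f` is the cross factor.  It is defined by recursion on the first element of the
enumeration, and it is zero if `J` does not have `N` elements. -/
def crossSum (q : ℂ) (u : ι → ℂ) : List (ℂ → ℂ) → Finset ι → ℂ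
  | [], J => if J = ∅ then 1 else 0
  | φ :: Φ, J => ∑ j ∈ J, φ (u j) * (∏ i ∈ J.erase j, cross q (u j) (u i)) *
      crossSum q u Φ (J.erase j)

theorem crossSum_eq_zero (q : ℂ) (u : ι → ℂ) (Φ : List (ℂ → ℂ)) :
    ∀ J : Finset ι, J.card ≠ Φ.length → crossSum q u Φ J = 0 := by
  induction Φ with
  | nil =>
    intro J hJ
    rw [crossSum, if_neg]
    rintro rfl
    exact hJ rfl
  | cons φ Φ ih =>
    intro J hJ
    refine Finset.sum_eq_zero fun j hj => ?_
    rw [ih, mul_zero]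
    rw [Finset.card_erase_of_mem hj]
    have := Finset.card_pos.2 ⟨j, hj⟩
    simp only [List.length_cons] at hJ
    omega

theorem crossSum_map {α : Type*} (q : ℂ) (u : ι → ℂ) (F G : α → ℂ → ℂ) (ρ : ℂ → ℂ)
    (h : ∀ a j, F a (u j) = ρ (u j) * G a (u j)) (l : List α) :
    ∀ J : Finset ι, crossSum q u (l.map F) J =
      (∏ j ∈ J, ρ (u j)) * crossSum q u (l.map G) J := by
  induction l with
  | nil =>
    intro J
    by_cases hJ : J = ∅ <;> simp [crossSum, hJ]
  | cons a l ih =>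
    intro J
    simp only [List.map_cons, crossSum, Finset.mul_sum]
    refine Finset.sum_congr rfl fun j hj => ?_
    rw [ih, h, ← Finset.mul_prod_erase J _ hj]
    ring

theorem crossSum_replicate (q : ℂ) {u : ι → ℂ} (hu : Function.Injective u) (ψ : ℂ → ℂ) (b : ℕ) :
    ∀ J : Finset ι, (1 - q) ^ b * crossSum q u (List.replicate b ψ) J =
      if J.card = b then qPoch q q b * ∏ j ∈ J, ψ (u j) else 0 := by
  induction b with
  | zero =>
    intro J
    by_cases hJ : J = ∅ <;> simp [crossSum, hJ, qPoch]
  | succ b ih =>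
    intro J
    split_ifs with hJ
    · have h1 : ∀ j ∈ J, (1 - q) ^ (b + 1) * (ψ (u j) *
          (∏ i ∈ J.erase j, cross q (u j) (u i)) *
            crossSum q u (List.replicate b ψ) (J.erase j)) =
          (qPoch q q b * ∏ j ∈ J, ψ (u j)) *
            ((1 - q) * ∏ i ∈ J.erase j, cross q (u j) (u i)) := by
        intro j hj
        have h2 := ih (J.erase j)
        rw [if_pos (by rw [Finset.card_erase_of_mem hj]; omega)] at h2
        rw [← Finset.mul_prod_erase J _ hj]
        linear_combination ((1 - q) * ψ (u j) * (∏ i ∈ J.erase j, cross q (u j) (u i))) * h2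
      rw [List.replicate_succ, crossSum, Finset.mul_sum, Finset.sum_congr rfl h1,
        ← Finset.mul_sum, ← Finset.mul_sum, one_sub_mul_sum_prod_cross q hu, hJ, qPoch_succ]
      ring
    · rw [crossSum_eq_zero _ _ _ _ (by simpa using hJ), mul_zero]

/-- Summing over the positions of the last `b` variables, when these variables enter through one
function `ψ` only, reduces a symmetrized sum to a sum over subsets. -/
theorem crossSum_append_replicate (q : ℂ) {u : ι → ℂ} (hu : Function.Injective u) (ψ : ℂ → ℂ)
    (b : ℕ) (Φ : List (ℂ → ℂ)) :
    ∀ J : Finset ι, (1 - q) ^ b * crossSum q u (Φ ++ List.replicate b ψ) J =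
      ∑ I ∈ J.powerset, if (J \ I).card = b then
        qPoch q q b * (∏ l ∈ J \ I, ψ (u l)) * (∏ i ∈ I, ∏ l ∈ J \ I, cross q (u i) (u l)) *
          crossSum q u Φ I else 0 := by
  induction Φ with
  | nil =>
    intro J
    rw [List.nil_append, crossSum_replicate q hu,
      Finset.sum_eq_single_of_mem ∅ (Finset.empty_mem_powerset J)]
    · simp [crossSum]
    · intro I _ hI
      simp [crossSum, hI]
  | cons φ Φ ih =>
    intro J
    rw [List.cons_append, crossSum, Finset.mul_sum]
    have hL : ∀ j ∈ J, (1 - q) ^ b * (φ (u j) * (∏ i ∈ J.erase j, cross q (u j) (u i)) *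
        crossSum q u (Φ ++ List.replicate b ψ) (J.erase j)) =
        ∑ I ∈ J.powerset, if j ∈ I then (if (J \ I).card = b then
          qPoch q q b * (∏ l ∈ J \ I, ψ (u l)) * (∏ i ∈ I, ∏ l ∈ J \ I, cross q (u i) (u l)) *
          (φ (u j) * (∏ i ∈ I.erase j, cross q (u j) (u i)) * crossSum q u Φ (I.erase j))
          else 0) else 0 := by
      intro j hj
      obtain ⟨K, hK, rfl⟩ : ∃ K, j ∉ K ∧ insert j K = J :=
        ⟨J.erase j, Finset.notMem_erase _ _, Finset.insert_erase hj⟩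
      have h0 : ∑ I ∈ K.powerset, (if j ∈ I then (if (insert j K \ I).card = b then
          qPoch q q b * (∏ l ∈ insert j K \ I, ψ (u l)) *
          (∏ i ∈ I, ∏ l ∈ insert j K \ I, cross q (u i) (u l)) *
          (φ (u j) * (∏ i ∈ I.erase j, cross q (u j) (u i)) * crossSum q u Φ (I.erase j))
          else 0) else 0) = 0 :=
        Finset.sum_eq_zero fun I hI => if_neg fun h => hK (Finset.mem_powerset.1 hI h)
      rw [Finset.sum_powerset_insert hK, Finset.erase_insert hK, h0, zero_add]
      have h1 := ih K
      rw [show (1 - q) ^ b * (φ (u j) * (∏ i ∈ K, cross q (u j) (u i)) *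
        crossSum q u (Φ ++ List.replicate b ψ) K) = (φ (u j) * (∏ i ∈ K, cross q (u j) (u i))) *
        ((1 - q) ^ b * crossSum q u (Φ ++ List.replicate b ψ) K) by ring, h1, Finset.mul_sum]
      refine Finset.sum_congr rfl fun I hI => ?_
      have hIK := Finset.mem_powerset.1 hI
      have hjI : j ∉ I := fun h => hK (hIK h)
      rw [if_pos (Finset.mem_insert_self _ _), Finset.insert_sdiff_insert,
        Finset.sdiff_insert_of_notMem hK, Finset.erase_insert hjI, Finset.prod_insert hjI]
      split_ifs
      · rw [← Finset.prod_sdiff hIK]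
        ring
      · rw [mul_zero]
    rw [Finset.sum_congr rfl hL, Finset.sum_comm]
    refine Finset.sum_congr rfl fun I hI => ?_
    rw [← Finset.sum_filter, Finset.filter_mem_eq_inter,
      Finset.inter_eq_right.2 (Finset.mem_powerset.1 hI)]
    split_ifs
    · rw [crossSum, Finset.mul_sum]
    · exact Finset.sum_const_zero

theorem crossTerm_succ (q : ℂ) {N : ℕ} (w : Fin (N + 1) → ℂ) :
    crossTerm q w = (∏ i : Fin N, cross q (w 0) (w i.succ)) *
      crossTerm q fun i => w i.succ := by
  unfold crossTerm
  rw [Fin.prod_univ_succ, Fin.prod_Ioi_zero]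
  congr 1
  exact Finset.prod_congr rfl fun α _ => Fin.prod_Ioi_succ _ _

/-- The sum over the symmetric group as a sum over enumerations. -/
theorem sum_perm_crossTerm (q : ℂ) (u : ι → ℂ) (N : ℕ) :
    ∀ (Φ : Fin N → ℂ → ℂ) (e : Fin N ↪ ι),
      ∑ σ : Equiv.Perm (Fin N), (crossTerm q fun i => u (e (σ i))) * ∏ i, Φ i (u (e (σ i))) =
        crossSum q u (List.ofFn Φ) (Finset.univ.map e) := by
  induction N with
  | zero =>
    intro Φ e
    simp [crossSum, crossTerm]
  | succ N ih =>
    intro Φ e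
    rw [← Equiv.sum_comp Equiv.Perm.decomposeFin.symm, Fintype.sum_prod_type, List.ofFn_succ,
      crossSum, Finset.sum_map]
    refine Finset.sum_congr rfl fun p _ => ?_
    let e' : Fin N ↪ ι := ((Fin.succEmb N).trans (Equiv.swap 0 p).toEmbedding).trans e
    have he' : ∀ i, e' i = e (Equiv.swap 0 p i.succ) := fun i => rfl
    have himg : (Finset.univ.map e).erase (e p) = Finset.univ.map e' := by
      ext x
      simp only [Finset.mem_erase, Finset.mem_map, Finset.mem_univ, true_and, he']
      constructor
      · rintro ⟨hx, a, rfl⟩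
        have ha : Equiv.swap 0 p a ≠ 0 := by
          intro h
          apply hx
          rw [← Equiv.swap_apply_self 0 p a, h, Equiv.swap_apply_left]
        obtain ⟨i, hi⟩ := Fin.exists_succ_eq.2 ha
        exact ⟨i, by rw [hi, Equiv.swap_apply_self]⟩
      · rintro ⟨i, rfl⟩
        refine ⟨fun h => ?_, _, rfl⟩
        have h1 : Equiv.swap 0 p i.succ = Equiv.swap 0 p 0 := by
          rw [Equiv.swap_apply_left]; exact e.injective h
        exact Fin.succ_ne_zero i ((Equiv.swap 0 p).injective h1)
    rw [himg, ← ih (fun i => Φ i.succ) e', Finset.mul_sum, Finset.prod_map]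
    refine Finset.sum_congr rfl fun τ _ => ?_
    rw [crossTerm_succ, Fin.prod_univ_succ]
    simp only [Equiv.Perm.decomposeFin_symm_apply_zero, Equiv.Perm.decomposeFin_symm_apply_succ,
      ← he']
    rw [Equiv.prod_comp τ fun i => cross q (u (e p)) (u (e' i))]
    ring

/-! ### Row operators and their exchange relations -/

/-- The restriction of a function of arrow configurations to a fixed number of arrows in the first
column. -/
def slice (φ : List ℕ → ℂ) (a : ℕ) : List ℕ → ℂ := fun l => φ (a :: l)

/-- The row operator with spectral parameter `u` and with `j` arrows entering from the left, acting
on functions of the arrow configurations of finitely many columns (a list holds the numbers of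
arrows in the columns, from left to right).  The value of `rowOp q s u j φ` at a configuration is
the sum of the weights of all rows above this configuration from which no arrow leaves to the right,
each multiplied by the value of `φ` at the configuration above the row.  The number of arrows `j'`
between the first two columns is at most `1`, and it determines the number `a + j - j'` of arrows
leaving the first column upwards; where the subtraction is truncated, the vertex weight is zero. -/
def rowOp (q s u : ℂ) : ℕ → (List ℕ → ℂ) → List ℕ → ℂ
  | j, φ, [] => if j = 0 then φ [] else 0
  | j, φ, a :: l => ∑ j' ∈ Finset.range 2, vertexWeight q s u a j (a + j - j') j' *
      rowOp q s u j' (slice φ (a + j - j')) l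

/-- The factor `1 - s² q^g` of the weight of a vertex with `a = g + 1` arrows from below, of which
one turns right. -/
def turnFactor (q s : ℂ) : ℕ → ℂ
  | 0 => 0
  | g + 1 => 1 - s ^ 2 * q ^ g

theorem turnFactor_zero (q s : ℂ) : turnFactor q s 0 = 0 := rfl

theorem turnFactor_succ (q s : ℂ) (g : ℕ) : turnFactor q s (g + 1) = 1 - s ^ 2 * q ^ g := rfl

theorem rowOp_linear (q s u : ℂ) (c d : ℂ) (l : List ℕ) :
    ∀ (j : ℕ) (φ ψ : List ℕ → ℂ), rowOp q s u j (c • φ + d • ψ) l =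
      c * rowOp q s u j φ l + d * rowOp q s u j ψ l := by
  induction l with
  | nil => intro j φ ψ; simp only [rowOp]; split_ifs <;> simp
  | cons a l ih =>
    intro j φ ψ
    simp only [rowOp, Finset.mul_sum]
    rw [← Finset.sum_add_distrib]
    refine Finset.sum_congr rfl fun j' _ => ?_
    have := ih j' (slice φ (a + j - j')) (slice ψ (a + j - j'))
    rw [show slice (c • φ + d • ψ) (a + j - j') =
      c • slice φ (a + j - j') + d • slice ψ (a + j - j') from rfl, this]
    ring

theorem rowOp_comb (q s u : ℂ) (c d : ℂ) (j : ℕ) (φ ψ : List ℕ → ℂ) :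
    rowOp q s u j (c • φ + d • ψ) = c • rowOp q s u j φ + d • rowOp q s u j ψ := by
  funext l
  simp [rowOp_linear]

theorem slice_rowOp_zero (q s u : ℂ) (φ : List ℕ → ℂ) (a : ℕ) :
    slice (rowOp q s u 0 φ) a =
      ((1 - s * q ^ a * u) * (1 - s * u)⁻¹) • rowOp q s u 0 (slice φ a) +
      (turnFactor q s a * u * (1 - s * u)⁻¹) • rowOp q s u 1 (slice φ (a - 1)) := by
  funext l
  change rowOp q s u 0 φ (a :: l) = _
  rcases a with _ | a <;>
    simp [rowOp, Finset.sum_range_succ, vertexWeight, turnFactor, div_eq_mul_inv]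

theorem slice_rowOp_one (q s u : ℂ) (φ : List ℕ → ℂ) (a : ℕ) :
    slice (rowOp q s u 1 φ) a =
      ((1 - q ^ (a + 1)) * (1 - s * u)⁻¹) • rowOp q s u 0 (slice φ (a + 1)) +
      ((u - s * q ^ a) * (1 - s * u)⁻¹) • rowOp q s u 1 (slice φ a) := by
  funext l
  change rowOp q s u 1 φ (a :: l) = _
  simp [rowOp, Finset.sum_range_succ, vertexWeight, div_eq_mul_inv]

theorem rowOp_of_two_le (q s u : ℂ) (j : ℕ) (φ : List ℕ → ℂ) : rowOp q s u (j + 2) φ = 0 := by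
  funext l
  rcases l with _ | ⟨a, l⟩
  · simp [rowOp]
  · simp [rowOp, vertexWeight]

theorem rowOp_cons (q s u : ℂ) (j : ℕ) (φ : List ℕ → ℂ) (a : ℕ) (l : List ℕ) :
    rowOp q s u j φ (a :: l) = slice (rowOp q s u j φ) a l := rfl

/-- The exchange relations (the part of the Yang-Baxter equation for rows from which no arrow leaves
to the right), by induction on the number of columns. -/
theorem rowOp_exchange_aux (q s : ℂ) (l : List ℕ) : ∀ (u v : ℂ), u ≠ v → ∀ φ,
    rowOp q s u 0 (rowOp q s v 0 φ) l = rowOp q s v 0 (rowOp q s u 0 φ) l ∧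
      rowOp q s u 1 (rowOp q s v 1 φ) l = rowOp q s v 1 (rowOp q s u 1 φ) l ∧
      (u - v) * rowOp q s u 1 (rowOp q s v 0 φ) l =
        (u - q * v) * rowOp q s v 0 (rowOp q s u 1 φ) l -
          (1 - q) * v * rowOp q s u 0 (rowOp q s v 1 φ) l := by
  induction l with
  | nil => intro u v _ φ; simp [rowOp]
  | cons a l ih =>
    intro u v huv φ
    have h0 := sub_ne_zero.2 huv
    have AA := fun b => (ih u v huv (slice φ b)).1
    have BB := fun b => (ih u v huv (slice φ b)).2.1
    have BA := fun b => (ih u v huv (slice φ b)).2.2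
    have BA' := fun b => (ih v u huv.symm (slice φ b)).2.2
    refine ⟨mul_left_cancel₀ h0 ?_, mul_left_cancel₀ h0 ?_, mul_left_cancel₀ h0 ?_⟩
    all_goals
      simp only [rowOp_cons, slice_rowOp_zero, slice_rowOp_one, rowOp_comb, Pi.add_apply,
        Pi.smul_apply, smul_eq_mul, add_tsub_cancel_right]
    · rcases a with _ | a
      · simp only [turnFactor_zero]
        linear_combination ((u - v) * (1 - s * q ^ 0 * u) * (1 - s * q ^ 0 * v) *
          (1 - s * u)⁻¹ * (1 - s * v)⁻¹) * AA 0
      · simp only [turnFactor_succ, add_tsub_cancel_right]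
        linear_combination ((u - v) * (1 - s * q ^ (a + 1) * u) * (1 - s * q ^ (a + 1) * v) *
          (1 - s * u)⁻¹ * (1 - s * v)⁻¹) * AA (a + 1) +
          ((1 - s ^ 2 * q ^ a) * u * (1 - s * q ^ a * v) * (1 - s * u)⁻¹ * (1 - s * v)⁻¹) * BA a +
          ((1 - s ^ 2 * q ^ a) * v * (1 - s * q ^ a * u) * (1 - s * u)⁻¹ * (1 - s * v)⁻¹) * BA' a +
          ((u - v) * (1 - s ^ 2 * q ^ a) * turnFactor q s a * u * v *
            (1 - s * u)⁻¹ * (1 - s * v)⁻¹) * BB (a - 1)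
    · linear_combination ((u - v) * (1 - q ^ (a + 1)) * (1 - q ^ (a + 1 + 1)) *
          (1 - s * u)⁻¹ * (1 - s * v)⁻¹) * AA (a + 1 + 1) +
        ((u - s * q ^ a) * (1 - q ^ (a + 1)) * (1 - s * u)⁻¹ * (1 - s * v)⁻¹) * BA (a + 1) +
        ((v - s * q ^ a) * (1 - q ^ (a + 1)) * (1 - s * u)⁻¹ * (1 - s * v)⁻¹) * BA' (a + 1) +
        ((u - v) * (u - s * q ^ a) * (v - s * q ^ a) * (1 - s * u)⁻¹ * (1 - s * v)⁻¹) * BB a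
    · rcases a with _ | a
      · simp only [turnFactor_zero, turnFactor_succ]
        linear_combination ((u - v) * (u - q * v) * (1 - s * q ^ 0 * v) * (1 - q ^ 1) *
            (1 - s * u)⁻¹ * (1 - s * v)⁻¹) * AA (0 + 1) +
          ((u - v) * (u - s * q ^ 0) * (1 - s * q ^ 0 * v) *
            (1 - s * u)⁻¹ * (1 - s * v)⁻¹) * BA 0
      · simp only [turnFactor_succ, add_tsub_cancel_right]
        linear_combination ((u - v) * (u - q * v) * (1 - s * q ^ (a + 1) * v) *
            (1 - q ^ (a + 1 + 1)) * (1 - s * u)⁻¹ * (1 - s * v)⁻¹) * AA (a + 1 + 1) +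
          (((u - v) * (u - s * q ^ (a + 1)) * (1 - s * q ^ (a + 1) * v) +
            (1 - q) * v * (1 - s ^ 2 * q ^ a) * u * (1 - q ^ (a + 1))) *
            (1 - s * u)⁻¹ * (1 - s * v)⁻¹) * BA (a + 1) +
          ((u - q * v) * (1 - s ^ 2 * q ^ a) * v * (1 - q ^ (a + 1)) *
            (1 - s * u)⁻¹ * (1 - s * v)⁻¹) * BA' (a + 1) +
          ((u - v) * (u - q * v) * (1 - s ^ 2 * q ^ a) * v * (u - s * q ^ a) *
            (1 - s * u)⁻¹ * (1 - s * v)⁻¹) * BB a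

/-- Row operators with the same number of arrows entering from the left commute. -/
theorem rowOp_comm (q s u v : ℂ) (j : ℕ) (φ : List ℕ → ℂ) :
    rowOp q s u j (rowOp q s v j φ) = rowOp q s v j (rowOp q s u j φ) := by
  rcases eq_or_ne u v with rfl | huv
  · rfl
  funext l
  match j with
  | 0 => exact (rowOp_exchange_aux q s l u v huv φ).1
  | 1 => exact (rowOp_exchange_aux q s l u v huv φ).2.1
  | j + 2 => simp only [rowOp_of_two_le]

theorem rowOp_one_rowOp_zero (q s : ℂ) {u v : ℂ} (huv : u ≠ v) (φ : List ℕ → ℂ) :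
    rowOp q s u 1 (rowOp q s v 0 φ) = cross q u v • rowOp q s v 0 (rowOp q s u 1 φ) +
      exch q v u • rowOp q s u 0 (rowOp q s v 1 φ) := by
  funext l
  have h0 := sub_ne_zero.2 huv
  have h1 := sub_ne_zero.2 huv.symm
  have h2 := (rowOp_exchange_aux q s l u v huv φ).2.2
  have h3 : exch q v u = -((1 - q) * v / (u - v)) := by
    unfold exch
    rw [← neg_sub u v, div_neg]
  simp only [Pi.add_apply, Pi.smul_apply, smul_eq_mul]
  rw [h3, cross]
  field_simp
  linear_combination h2

instance (q s : ℂ) (j : ℕ) :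
    LeftCommutative fun (u : ℂ) (φ : List ℕ → ℂ) => rowOp q s u j φ :=
  ⟨fun u v φ => rowOp_comm q s u v j φ⟩

/-! ### Products of row operators -/

/-- The product of the commuting row operators with `j` arrows entering from the left and with the
spectral parameters `u i`, for `i ∈ I`. -/
def rowProd {ι : Type*} (q s : ℂ) (u : ι → ℂ) (j : ℕ) (I : Finset ι) (φ : List ℕ → ℂ) :
    List ℕ → ℂ :=
  (I.val.map u).foldr (fun w ψ => rowOp q s w j ψ) φ

theorem rowProd_empty {ι : Type*} (q s : ℂ) (u : ι → ℂ) (j : ℕ) (φ : List ℕ → ℂ) :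
    rowProd q s u j ∅ φ = φ := rfl

theorem rowProd_insert (q s : ℂ) (u : ι → ℂ) (j : ℕ) {k : ι} {I : Finset ι} (hk : k ∉ I)
    (φ : List ℕ → ℂ) :
    rowProd q s u j (insert k I) φ = rowProd q s u j I (rowOp q s (u k) j φ) := by
  unfold rowProd
  rw [Finset.insert_val_of_notMem hk, ← Multiset.singleton_add, add_comm, Multiset.map_add,
    Multiset.foldr_add, Multiset.map_singleton, Multiset.foldr_singleton]

theorem rowProd_comb (q s : ℂ) (u : ι → ℂ) (j : ℕ) (I : Finset ι) (c d : ℂ) :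
    ∀ φ ψ : List ℕ → ℂ, rowProd q s u j I (c • φ + d • ψ) =
      c • rowProd q s u j I φ + d • rowProd q s u j I ψ := by
  induction I using Finset.induction_on with
  | empty => intro φ ψ; rfl
  | insert k I hk ih => intro φ ψ; simp only [rowProd_insert _ _ _ _ hk, rowOp_comb, ih]

theorem rowOp_zero_vacuum (q s : ℂ) {u : ℂ} (hu : 1 - s * u ≠ 0) (L : ℕ) :
    ∀ φ, rowOp q s u 0 φ (List.replicate L 0) = φ (List.replicate L 0) := by
  induction L with
  | zero => intro φ; simp [rowOp]
  | succ L ih =>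
    intro φ
    rw [List.replicate_succ, rowOp_cons, slice_rowOp_zero]
    simp [turnFactor, hu, ih, slice]

/-- Moving a row without an arrow from the left through rows with one arrow from the left, to the
bottom, where it acts trivially on the empty configuration. -/
theorem rowProd_rowOp_zero_vacuum (q s : ℂ) {u : ι → ℂ} (hinj : Function.Injective u)
    (hu : ∀ i, 1 - s * u i ≠ 0) (L : ℕ) (I : Finset ι) : ∀ k, k ∉ I → ∀ φ,
    rowProd q s u 1 I (rowOp q s (u k) 0 φ) (List.replicate L 0) =
      (∏ i ∈ I, cross q (u i) (u k)) * rowProd q s u 1 I φ (List.replicate L 0) +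
      ∑ j ∈ I, exch q (u k) (u j) * (∏ i ∈ I.erase j, cross q (u i) (u j)) *
        rowProd q s u 1 (insert k (I.erase j)) φ (List.replicate L 0) := by
  induction I using Finset.induction_on with
  | empty =>
    intro k _ φ
    simp [rowProd_empty, rowOp_zero_vacuum q s (hu k)]
  | insert w I hw ih =>
    intro k hk φ
    have hkw : k ≠ w := by rintro rfl; exact hk (Finset.mem_insert_self _ _)
    have hkI : k ∉ I := fun h => hk (Finset.mem_insert_of_mem h)
    have huwk : u w ≠ u k := fun h => hkw (hinj h).symm
    rw [rowProd_insert _ _ _ _ hw, rowOp_one_rowOp_zero q s huwk, rowProd_comb]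
    simp only [Pi.add_apply, Pi.smul_apply, smul_eq_mul]
    rw [ih k hkI, ih w hw, Finset.sum_insert hw, Finset.erase_insert hw, Finset.prod_insert hw,
      rowProd_insert _ _ _ _ hw, rowProd_insert _ _ _ _ hkI]
    have hsum : ∑ j ∈ I, exch q (u k) (u j) *
          (∏ i ∈ (insert w I).erase j, cross q (u i) (u j)) *
          rowProd q s u 1 (insert k ((insert w I).erase j)) φ (List.replicate L 0) =
        cross q (u w) (u k) * ∑ j ∈ I, exch q (u k) (u j) *
          (∏ i ∈ I.erase j, cross q (u i) (u j)) *
          rowProd q s u 1 (insert k (I.erase j)) (rowOp q s (u w) 1 φ) (List.replicate L 0) +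
        exch q (u k) (u w) * ∑ j ∈ I, exch q (u w) (u j) *
          (∏ i ∈ I.erase j, cross q (u i) (u j)) *
          rowProd q s u 1 (insert w (I.erase j)) (rowOp q s (u k) 1 φ) (List.replicate L 0) := by
      rw [Finset.mul_sum, Finset.mul_sum, ← Finset.sum_add_distrib]
      refine Finset.sum_congr rfl fun j hj => ?_
      have hwj : w ≠ j := by rintro rfl; exact hw hj
      have hkj : k ≠ j := by rintro rfl; exact hkI hj
      have hwI : w ∉ I.erase j := fun h => hw (Finset.mem_of_mem_erase h)
      have hkI' : k ∉ I.erase j := fun h => hkI (Finset.mem_of_mem_erase h)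
      have hwkI : w ∉ insert k (I.erase j) := by
        simp [hkw.symm, hw]
      have hkwI : k ∉ insert w (I.erase j) := by
        simp [hkw, hkI]
      rw [Finset.erase_insert_of_ne hwj, Finset.prod_insert hwI,
        ← rowProd_insert _ _ _ _ hwkI, ← rowProd_insert _ _ _ _ hkwI,
        Finset.insert_comm w k]
      have hcoef : exch q (u k) (u j) * cross q (u w) (u j) =
          cross q (u w) (u k) * exch q (u k) (u j) + exch q (u k) (u w) * exch q (u w) (u j) := by
        have h1 := sub_ne_zero.2 huwk
        have h2 := sub_ne_zero.2 huwk.symm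
        have h3 := sub_ne_zero.2 fun h => hkj (hinj h)
        have h4 := sub_ne_zero.2 fun h => hwj (hinj h)
        rw [show exch q (u k) (u w) = -((1 - q) * u k / (u w - u k)) by
          unfold exch; rw [← neg_sub (u w) (u k), div_neg]]
        unfold cross exch
        field_simp
        ring
      linear_combination ((∏ i ∈ I.erase j, cross q (u i) (u j)) * rowProd q s u 1
        (insert k (insert w (I.erase j))) φ (List.replicate L 0)) * hcoef
    rw [hsum]
    ring

/-! ### Splitting off the leftmost column -/

/-- Expansion of a product of row operators along the first column: `I` is the set of the rows in
which an arrow enters the remaining columns, once these rows have been moved past the others.  The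
state of the first column above `m` rows, of which `h` have let an arrow pass, is `state m h`, and
`x` and `y` are the weights of the next vertex when no arrow, respectively one arrow, leaves it to
the right.  The coefficients `c` are characterized by what happens when one more row `k` is put on
top. -/
theorem rowProd_cons_vacuum (q s : ℂ) {u : ι → ℂ} (hinj : Function.Injective u)
    (hu : ∀ i, 1 - s * u i ≠ 0) (L left : ℕ) (state : ℕ → ℕ → ℕ) (x y : ℕ → ℕ → ℂ → ℂ)
    (hslice : ∀ m h w φ, h ≤ m → slice (rowOp q s w left φ) (state m h) =
      x m h w • rowOp q s w 0 (slice φ (state (m + 1) h)) +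
      y m h w • rowOp q s w 1 (slice φ (state (m + 1) (h + 1))))
    (c : Finset ι → Finset ι → ℂ) (hc0 : c ∅ ∅ = 1)
    (hcx : ∀ J I k, k ∉ J → I ⊆ J →
      c (insert k J) I = c J I * x J.card I.card (u k) * ∏ i ∈ I, cross q (u i) (u k))
    (hcy : ∀ J I k, k ∉ J → I ⊆ J →
      c (insert k J) (insert k I) = c J I * y J.card I.card (u k) +
        ∑ j ∈ J \ I, c J (insert j I) * x J.card (I.card + 1) (u k) *
          (exch q (u k) (u j) * ∏ i ∈ I, cross q (u i) (u j)))
    (J : Finset ι) : ∀ φ,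
    rowProd q s u left J φ (state 0 0 :: List.replicate L 0) = ∑ I ∈ J.powerset,
      c J I * rowProd q s u 1 I (slice φ (state J.card I.card)) (List.replicate L 0) := by
  induction J using Finset.induction_on with
  | empty =>
    intro φ
    simp [rowProd_empty, hc0, slice]
  | insert k J hk ih =>
    intro φ
    rw [rowProd_insert _ _ _ _ hk, ih, Finset.sum_powerset_insert hk,
      Finset.card_insert_of_notMem hk]
    have hterm : ∀ I ∈ J.powerset,
        c J I * rowProd q s u 1 I (slice (rowOp q s (u k) left φ) (state J.card I.card))
          (List.replicate L 0) =
        (c (insert k J) I * rowProd q s u 1 I (slice φ (state (J.card + 1) I.card))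
          (List.replicate L 0) +
        c J I * y J.card I.card (u k) * rowProd q s u 1 (insert k I)
          (slice φ (state (J.card + 1) (I.card + 1))) (List.replicate L 0)) +
        ∑ j ∈ I, c J I * x J.card I.card (u k) *
          (exch q (u k) (u j) * ∏ i ∈ I.erase j, cross q (u i) (u j)) *
          rowProd q s u 1 (insert k (I.erase j)) (slice φ (state (J.card + 1) I.card))
            (List.replicate L 0) := by
      intro I hI
      have hIJ := Finset.mem_powerset.1 hI
      have hkI : k ∉ I := fun h => hk (hIJ h)
      rw [hslice _ _ _ _ (Finset.card_le_card hIJ), rowProd_comb, ← rowProd_insert _ _ _ _ hkI]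
      simp only [Pi.add_apply, Pi.smul_apply, smul_eq_mul]
      rw [rowProd_rowOp_zero_vacuum q s hinj hu L I k hkI, hcx J I k hk hIJ, mul_add, mul_add,
        mul_add, Finset.mul_sum, Finset.mul_sum, add_right_comm]
      refine congrArg₂ _ (congrArg₂ _ (by ring) (by ring)) ?_
      exact Finset.sum_congr rfl fun j _ => by ring
    rw [Finset.sum_congr rfl hterm, Finset.sum_add_distrib, Finset.sum_add_distrib,
      sum_powerset_sum_mem, add_assoc, ← Finset.sum_add_distrib]
    congr 1
    refine Finset.sum_congr rfl fun I hI => ?_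
    have hIJ := Finset.mem_powerset.1 hI
    have hkI : k ∉ I := fun h => hk (hIJ h)
    rw [hcy J I k hk hIJ, Finset.card_insert_of_notMem hkI, add_mul, Finset.sum_mul]
    congr 1
    refine Finset.sum_congr rfl fun j hj => ?_
    have hjI := (Finset.mem_sdiff.1 hj).2
    rw [Finset.erase_insert hjI, Finset.card_insert_of_notMem hjI]

/-- The product of the cross factors over `I × K`. -/
def crossProd {ι : Type*} (q : ℂ) (u : ι → ℂ) (I K : Finset ι) : ℂ :=
  ∏ i ∈ I, ∏ l ∈ K, cross q (u i) (u l)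

theorem crossProd_insert_left (q : ℂ) (u : ι → ℂ) {k : ι} {I : Finset ι} (K : Finset ι)
    (hk : k ∉ I) :
    crossProd q u (insert k I) K = (∏ l ∈ K, cross q (u k) (u l)) * crossProd q u I K :=
  Finset.prod_insert hk

theorem crossProd_insert_right (q : ℂ) (u : ι → ℂ) {k : ι} (I : Finset ι) {K : Finset ι}
    (hk : k ∉ K) :
    crossProd q u I (insert k K) = (∏ i ∈ I, cross q (u i) (u k)) * crossProd q u I K := by
  unfold crossProd
  rw [← Finset.prod_mul_distrib]
  exact Finset.prod_congr rfl fun i _ => Finset.prod_insert hk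

theorem sdiff_insert_eq_erase (J I : Finset ι) (j : ι) : J \ insert j I = (J \ I).erase j := by
  ext
  simp only [Finset.mem_sdiff, Finset.mem_insert, Finset.mem_erase]
  tauto

theorem crossProd_erase_mul (q : ℂ) (u : ι → ℂ) {I K : Finset ι} {j : ι} (hjI : j ∉ I)
    (hjK : j ∈ K) :
    crossProd q u (insert j I) (K.erase j) * ∏ i ∈ I, cross q (u i) (u j) =
      crossProd q u I K * ∏ l ∈ K.erase j, cross q (u j) (u l) := by
  rw [crossProd_insert_left _ _ _ hjI]
  nth_rewrite 3 [← Finset.insert_erase hjK]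
  rw [crossProd_insert_right _ _ _ (Finset.notMem_erase _ _)]
  ring

/-- The first column of the model with one arrow entering every row. -/
theorem rowProd_one_cons_vacuum (q s : ℂ) {u : ι → ℂ} (hinj : Function.Injective u)
    (hu : ∀ i, 1 - s * u i ≠ 0) (L : ℕ) (J : Finset ι) (φ : List ℕ → ℂ) :
    rowProd q s u 1 J φ (List.replicate (L + 1) 0) = ∑ I ∈ J.powerset,
      (qPoch q q (J \ I).card * (∏ i ∈ I, (u i - s)) * crossProd q u I (J \ I) *
        ∏ j ∈ J, (1 - s * u j)⁻¹) *
      rowProd q s u 1 I (slice φ (J.card - I.card)) (List.replicate L 0) := by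
  refine rowProd_cons_vacuum q s hinj hu L 1 (fun m h => m - h)
    (fun m h w => (1 - q ^ (m - h + 1)) * (1 - s * w)⁻¹)
    (fun m h w => (w - s * q ^ (m - h)) * (1 - s * w)⁻¹) ?_
    (fun J I => qPoch q q (J \ I).card * (∏ i ∈ I, (u i - s)) * crossProd q u I (J \ I) *
        ∏ j ∈ J, (1 - s * u j)⁻¹) ?_ ?_ ?_ J φ
  · intro m h w φ hm
    rw [slice_rowOp_one, Nat.add_sub_add_right, Nat.sub_add_comm hm]
  · simp [qPoch, crossProd]
  · intro J I k hk hIJ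
    have hkI : k ∉ I := fun h => hk (hIJ h)
    have hkK : k ∉ J \ I := fun h => hk (Finset.mem_sdiff.1 h).1
    rw [Finset.insert_sdiff_of_notMem _ hkI, Finset.card_insert_of_notMem hkK, qPoch_succ,
      crossProd_insert_right _ _ _ hkK, Finset.prod_insert hk, Finset.card_sdiff_of_subset hIJ]
    ring
  · intro J I k hk hIJ
    have hkI : k ∉ I := fun h => hk (hIJ h)
    rw [Finset.insert_sdiff_insert, Finset.sdiff_insert_of_notMem hk, Finset.prod_insert hkI,
      crossProd_insert_left _ _ _ hkI, Finset.prod_insert hk]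
    have hv : ∀ j ∈ J \ I, u k ≠ u j := fun j hj h =>
      hk (hinj h ▸ (Finset.mem_sdiff.1 hj).1)
    have hcard := Finset.card_sdiff_of_subset hIJ
    have hterm : ∀ j ∈ J \ I,
        qPoch q q (J \ insert j I).card * (∏ i ∈ insert j I, (u i - s)) *
          crossProd q u (insert j I) (J \ insert j I) * (∏ j ∈ J, (1 - s * u j)⁻¹) *
          ((1 - q ^ (J.card - (I.card + 1) + 1)) * (1 - s * u k)⁻¹) *
          (exch q (u k) (u j) * ∏ i ∈ I, cross q (u i) (u j)) =
        (qPoch q q (J \ I).card * (∏ i ∈ I, (u i - s)) * crossProd q u I (J \ I) *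
          (∏ j ∈ J, (1 - s * u j)⁻¹) * (1 - s * u k)⁻¹) *
          (u k * ((1 - q) * u j / (u k - u j) *
              ∏ l ∈ (J \ I).erase j, cross q (u j) (u l)) -
            s * (exch q (u k) (u j) * ∏ l ∈ (J \ I).erase j, cross q (u j) (u l))) := by
      intro j hj
      have hjI := (Finset.mem_sdiff.1 hj).2
      have hpos := Finset.card_pos.2 ⟨j, hj⟩
      rw [sdiff_insert_eq_erase, Finset.prod_insert hjI, Finset.card_erase_of_mem hj]
      have h1 := crossProd_erase_mul q u hjI hj
      have h2 : qPoch q q (J \ I).card = qPoch q q ((J \ I).card - 1) *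
          (1 - q ^ (J.card - (I.card + 1) + 1)) := by
        obtain ⟨g, hg⟩ : ∃ g, (J \ I).card = g + 1 := ⟨_, (Nat.sub_add_cancel hpos).symm⟩
        rw [hg, qPoch_succ, Nat.add_sub_cancel, show J.card - (I.card + 1) + 1 = g + 1 by omega,
          pow_succ']
      have h3 : exch q (u k) (u j) = u k * ((1 - q) / (u k - u j)) := by unfold exch; ring
      rw [h2, h3]
      linear_combination (qPoch q q ((J \ I).card - 1) * (1 - q ^ (J.card - (I.card + 1) + 1)) *
        ((u j - s) * ∏ i ∈ I, (u i - s)) * (∏ j ∈ J, (1 - s * u j)⁻¹) * (1 - s * u k)⁻¹ *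
        (u k * ((1 - q) / (u k - u j)))) * h1
    rw [Finset.sum_congr rfl hterm, ← Finset.mul_sum, Finset.sum_sub_distrib, ← Finset.mul_sum,
      ← Finset.mul_sum, ← hcard]
    have h1 := prod_cross_eq_one_add q hinj (J \ I) (u k) hv
    have h2 := prod_cross_eq_pow_add q hinj (J \ I) (u k) hv
    linear_combination (qPoch q q (J \ I).card * (∏ i ∈ I, (u i - s)) * crossProd q u I (J \ I) *
      (∏ j ∈ J, (1 - s * u j)⁻¹) * (1 - s * u k)⁻¹) * (u k * h1 - s * h2)

/-- The first column of the model without arrows entering from the left and with `n` arrows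
entering the first column from below. -/
theorem rowProd_zero_cons_vacuum (q s : ℂ) {u : ι → ℂ} (hinj : Function.Injective u)
    (hu : ∀ i, 1 - s * u i ≠ 0) (L n : ℕ) (J : Finset ι) (φ : List ℕ → ℂ) :
    rowProd q s u 0 J φ (n :: List.replicate L 0) = ∑ I ∈ J.powerset,
      ((∏ i ∈ Finset.range I.card, turnFactor q s (n - i)) * (∏ i ∈ I, u i) *
        (∏ l ∈ J \ I, (1 - s * q ^ (n - I.card) * u l)) * crossProd q u I (J \ I) *
        ∏ j ∈ J, (1 - s * u j)⁻¹) *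
      rowProd q s u 1 I (slice φ (n - I.card)) (List.replicate L 0) := by
  refine rowProd_cons_vacuum q s hinj hu L 0 (fun _ h => n - h)
    (fun _ h w => (1 - s * q ^ (n - h) * w) * (1 - s * w)⁻¹)
    (fun _ h w => turnFactor q s (n - h) * w * (1 - s * w)⁻¹) ?_
    (fun J I => (∏ i ∈ Finset.range I.card, turnFactor q s (n - i)) * (∏ i ∈ I, u i) *
        (∏ l ∈ J \ I, (1 - s * q ^ (n - I.card) * u l)) * crossProd q u I (J \ I) *
        ∏ j ∈ J, (1 - s * u j)⁻¹) ?_ ?_ ?_ J φ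
  · intro m h w φ _
    rw [slice_rowOp_zero]
    rfl
  · simp [crossProd]
  · intro J I k hk hIJ
    have hkI : k ∉ I := fun h => hk (hIJ h)
    have hkK : k ∉ J \ I := fun h => hk (Finset.mem_sdiff.1 h).1
    rw [Finset.insert_sdiff_of_notMem _ hkI, Finset.prod_insert hkK,
      crossProd_insert_right _ _ _ hkK, Finset.prod_insert hk]
    ring
  · intro J I k hk hIJ
    have hkI : k ∉ I := fun h => hk (hIJ h)
    rw [Finset.insert_sdiff_insert, Finset.sdiff_insert_of_notMem hk, Finset.prod_insert hkI,
      crossProd_insert_left _ _ _ hkI, Finset.prod_insert hk, Finset.card_insert_of_notMem hkI,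
      Finset.prod_range_succ]
    have hv : ∀ j ∈ J \ I, u k ≠ u j := fun j hj h =>
      hk (hinj h ▸ (Finset.mem_sdiff.1 hj).1)
    have hterm : ∀ j ∈ J \ I,
        (∏ i ∈ Finset.range (insert j I).card, turnFactor q s (n - i)) *
          (∏ i ∈ insert j I, u i) *
          (∏ l ∈ J \ insert j I, (1 - s * q ^ (n - (insert j I).card) * u l)) *
          crossProd q u (insert j I) (J \ insert j I) * (∏ j ∈ J, (1 - s * u j)⁻¹) *
          ((1 - s * q ^ (n - (I.card + 1)) * u k) * (1 - s * u k)⁻¹) *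
          (exch q (u k) (u j) * ∏ i ∈ I, cross q (u i) (u j)) =
        ((∏ i ∈ Finset.range I.card, turnFactor q s (n - i)) * turnFactor q s (n - I.card) *
          (∏ i ∈ I, u i) * u k * crossProd q u I (J \ I) *
          (∏ j ∈ J, (1 - s * u j)⁻¹) * (1 - s * u k)⁻¹ *
          (1 - s * q ^ (n - (I.card + 1)) * u k)) *
          (((1 - q) * u j / (u k - u j) *
              ∏ l ∈ (J \ I).erase j, (1 - s * q ^ (n - (I.card + 1)) * u l)) *
              ∏ l ∈ (J \ I).erase j, cross q (u j) (u l)) := by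
      intro j hj
      have hjI := (Finset.mem_sdiff.1 hj).2
      rw [sdiff_insert_eq_erase, Finset.prod_insert hjI, Finset.card_insert_of_notMem hjI,
        Finset.prod_range_succ]
      have h1 := crossProd_erase_mul q u hjI hj
      have h3 : exch q (u k) (u j) = u k * ((1 - q) / (u k - u j)) := by unfold exch; ring
      rw [h3]
      linear_combination ((∏ i ∈ Finset.range I.card, turnFactor q s (n - i)) *
        turnFactor q s (n - I.card) * (u j * ∏ i ∈ I, u i) *
        (∏ l ∈ (J \ I).erase j, (1 - s * q ^ (n - (I.card + 1)) * u l)) *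
        (∏ j ∈ J, (1 - s * u j)⁻¹) *
        ((1 - s * q ^ (n - (I.card + 1)) * u k) * (1 - s * u k)⁻¹) *
        (u k * ((1 - q) / (u k - u j)))) * h1
    rw [Finset.sum_congr rfl hterm, ← Finset.mul_sum]
    have h1 := prod_cross_mul_prod_eq q (s * q ^ (n - (I.card + 1))) hinj (J \ I) (u k) hv
    -- If no arrow is left in the column, then the weight of the turn vanishes; otherwise the
    -- exponent of `q` drops by one.
    rcases Nat.lt_or_ge I.card n with hn | hn
    · have h2 : q ^ (n - I.card) = q ^ (n - (I.card + 1)) * q := by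
        rw [← pow_succ]; congr 1; omega
      rw [h2, ← mul_assoc s]
      linear_combination ((∏ i ∈ Finset.range I.card, turnFactor q s (n - i)) *
        turnFactor q s (n - I.card) * (∏ i ∈ I, u i) * u k * crossProd q u I (J \ I) *
        (∏ j ∈ J, (1 - s * u j)⁻¹) * (1 - s * u k)⁻¹) * h1
    · rw [Nat.sub_eq_zero_of_le hn, turnFactor_zero]
      ring

/-! ### Explicit partition functions -/

/-- The indicator function of an arrow configuration. -/
def pointMass (d : List ℕ) : List ℕ → ℂ := fun l => if l = d then 1 else 0

/-- The final positions of the paths, in decreasing order, when the list `d` holds the numbers of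
paths ending in the columns `0, 1, 2, …`. -/
def positions : List ℕ → List ℕ
  | [] => []
  | m :: d => (positions d).map Nat.succ ++ List.replicate m 0

theorem slice_pointMass (m : ℕ) (d : List ℕ) (a : ℕ) :
    slice (pointMass (m :: d)) a = if a = m then pointMass d else 0 := by
  funext l
  by_cases h : a = m <;> simp [slice, pointMass, h]

theorem rowOp_zero_right (q s u : ℂ) (j : ℕ) : rowOp q s u j 0 = 0 := by
  simpa using rowOp_comb q s u 0 0 j 0 0

theorem rowProd_zero_right (q s : ℂ) (u : ι → ℂ) (j : ℕ) (I : Finset ι) :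
    rowProd q s u j I 0 = 0 := by
  simpa using rowProd_comb q s u j I 0 0 0 0

theorem rowProd_insert' (q s : ℂ) (u : ι → ℂ) (j : ℕ) {k : ι} {I : Finset ι} (hk : k ∉ I)
    (φ : List ℕ → ℂ) :
    rowProd q s u j (insert k I) φ = rowOp q s (u k) j (rowProd q s u j I φ) := by
  unfold rowProd
  rw [Finset.insert_val_of_notMem hk, Multiset.map_cons, Multiset.foldr_cons]

theorem rowProd_one_pointMass (q s : ℂ) {u : ι → ℂ} (hinj : Function.Injective u)
    (hu : ∀ i, 1 - s * u i ≠ 0) (d : List ℕ) : ∀ J : Finset ι,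
    rowProd q s u 1 J (pointMass d) (List.replicate d.length 0) =
      (1 - q) ^ J.card * (∏ j ∈ J, (1 - s * u j)⁻¹) *
        crossSum q u ((positions d).map fun m w => ((w - s) / (1 - s * w)) ^ m) J := by
  induction d with
  | nil =>
    intro J
    induction J using Finset.induction_on with
    | empty => simp [rowProd_empty, pointMass, positions, crossSum]
    | insert k J hk _ =>
      rw [rowProd_insert' _ _ _ _ hk]
      simp [rowOp, positions, crossSum]
  | cons m d ih =>
    intro J
    rw [List.length_cons, rowProd_one_cons_vacuum q s hinj hu, positions, List.map_append,
      List.map_map, List.map_replicate]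
    rcases Nat.lt_or_ge J.card m with hm | hm
    · rw [crossSum_eq_zero _ _ _ J (by simp; omega), mul_zero]
      refine Finset.sum_eq_zero fun I _ => ?_
      rw [slice_pointMass, if_neg (by omega), rowProd_zero_right, Pi.zero_apply, mul_zero]
    · rw [← Nat.sub_add_cancel hm, pow_add, Nat.sub_add_cancel hm,
        show ∀ a b c e : ℂ, a * b * c * e = a * c * (b * e) by intros; ring,
        crossSum_append_replicate q hinj, Finset.mul_sum]
      refine Finset.sum_congr rfl fun I hI => ?_
      have hIJ := Finset.mem_powerset.1 hI
      have hcard := Finset.card_sdiff_of_subset hIJ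
      have hle := Finset.card_le_card hIJ
      rw [slice_pointMass, hcard]
      split_ifs with h
      · have hξ : ∀ (a : ℕ) (j : ι), ((fun m w => ((w - s) / (1 - s * w)) ^ m) ∘ Nat.succ) a (u j) =
            ((u j - s) / (1 - s * u j)) * ((u j - s) / (1 - s * u j)) ^ a := by
          intro a j
          exact pow_succ' _ _
        rw [ih, crossSum_map q u _ (fun m w => ((w - s) / (1 - s * w)) ^ m)
          (fun w => (w - s) / (1 - s * w)) hξ, h, show J.card - m = I.card by omega]
        simp only [div_eq_mul_inv, Finset.prod_mul_distrib, pow_zero, Finset.prod_const_one]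
        unfold crossProd
        ring
      · rw [rowProd_zero_right, Pi.zero_apply, mul_zero, mul_zero]

theorem prod_turnFactor (q s : ℂ) (k h : ℕ) :
    qPoch (s ^ 2) q k * ∏ i ∈ Finset.range h, turnFactor q s (k + h - i) =
      qPoch (s ^ 2) q (k + h) := by
  induction h with
  | zero => simp
  | succ h ih =>
    rw [Finset.prod_range_succ', ← Nat.add_assoc, qPoch_succ, ← ih]
    simp only [Nat.add_sub_add_right, Nat.sub_zero, turnFactor_succ]
    ring

/-- The partition function with `k + h` paths entering the first column from below, of which `k` stay
in this column.  The function `F m`, which belongs to a path ending in column `m + 1`, is prescribed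
at the spectral parameters only, so that it may be any rational expression with these values. -/
theorem rowProd_zero_pointMass (q s : ℂ) {u : ι → ℂ} (hinj : Function.Injective u)
    (hu : ∀ i, 1 - s * u i ≠ 0) (k h : ℕ) (d : List ℕ) (J : Finset ι) (hJ : h ≤ J.card)
    (F : ℕ → ℂ → ℂ)
    (hF : ∀ m j, F m (u j) = u j / (1 - s * u j) * ((u j - s) / (1 - s * u j)) ^ m) :
    qPoch q q (J.card - h) * (qPoch (s ^ 2) q k *
      rowProd q s u 0 J (pointMass (k :: d)) ((k + h) :: List.replicate d.length 0)) =
      qPoch (s ^ 2) q (k + h) * ((1 - q) ^ J.card * (∏ j ∈ J, (1 - s * u j)⁻¹)) *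
        crossSum q u ((positions d).map F ++
          List.replicate (J.card - h) (fun w => 1 - s * q ^ k * w)) J := by
  rw [rowProd_zero_cons_vacuum q s hinj hu, ← prod_turnFactor]
  nth_rewrite 2 [← Nat.add_sub_cancel' hJ]
  rw [pow_add, show ∀ a b c e f : ℂ, a * (b * c * e) * f = a * b * e * (c * f) by intros; ring,
    crossSum_append_replicate q hinj, Finset.mul_sum, Finset.mul_sum, Finset.mul_sum]
  refine Finset.sum_congr rfl fun I hI => ?_
  have hIJ := Finset.mem_powerset.1 hI
  have hcard := Finset.card_sdiff_of_subset hIJ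
  have hle := Finset.card_le_card hIJ
  rw [slice_pointMass]
  by_cases hIh : I.card = h
  · rw [if_pos (by omega), if_pos (by omega), rowProd_one_pointMass q s hinj hu,
      crossSum_map q u F (fun m w => ((w - s) / (1 - s * w)) ^ m)
        (fun w => w / (1 - s * w)) hF, hIh, Nat.add_sub_cancel]
    simp only [div_eq_mul_inv, Finset.prod_mul_distrib]
    unfold crossProd
    ring
  · rw [if_neg (show (J \ I).card ≠ J.card - h by omega), mul_zero]
    split_ifs with hk
    · -- More rows than arrows: the product of the weights of the turns contains a zero factor.
      rw [Finset.prod_eq_zero (i := k + h) (Finset.mem_range.2 (by omega))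
        (by rw [Nat.sub_self, turnFactor_zero])]
      ring
    · rw [rowProd_zero_right, Pi.zero_apply, mul_zero, mul_zero, mul_zero]

/-- Every row without an arrow from the left takes at most one arrow out of the first column. -/
theorem rowProd_zero_eq_zero (q s : ℂ) (u : ι → ℂ) (a : ℕ) (l : List ℕ) (J : Finset ι) :
    ∀ φ, (∀ b, a - J.card ≤ b → slice φ b = 0) → rowProd q s u 0 J φ (a :: l) = 0 := by
  induction J using Finset.induction_on with
  | empty =>
    intro φ hφ
    exact congrFun (hφ a (Nat.sub_le _ _)) l
  | insert k J hk ih =>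
    intro φ hφ
    rw [Finset.card_insert_of_notMem hk] at hφ
    rw [rowProd_insert _ _ _ _ hk]
    refine ih _ fun b hb => ?_
    rw [slice_rowOp_zero, hφ b (by omega), hφ (b - 1) (by omega)]
    simp [rowOp_zero_right]

/-! ### Path collections and row operators -/

/-- The first `L` entries of an arrow configuration. -/
def configList (L : ℕ) (c : ℕ → ℕ) : List ℕ := List.ofFn fun i : Fin L => c i

theorem configList_succ (L : ℕ) (c : ℕ → ℕ) :
    configList (L + 1) c = c 0 :: configList L fun x => c (x + 1) := by
  simp [configList, List.ofFn_succ]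

/-- The possible arrow numbers in one row of the columns `0, …, L - 1`, for the configuration `c`
below the row: `out` is the configuration above the row, and `horiz x` is the number of arrows
entering column `x` from the left. -/
@[ext]
structure Row (L left : ℕ) (c : ℕ → ℕ) where
  out : ℕ → ℕ
  horiz : ℕ → ℕ
  horiz_left : horiz 0 = left
  preserve : ∀ x, c x + horiz x = out x + horiz (x + 1)
  horiz_right : ∀ x, L ≤ x → horiz x = 0

/-- A row is its first vertex, given by the number of arrows leaving it to the right, together with
the rest of the row. -/
def Row.consEquiv (L left : ℕ) (c : ℕ → ℕ) :
    Row (L + 1) left c ≃ Σ j : Fin (c 0 + left + 1), Row L j fun x => c (x + 1) where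
  toFun r := ⟨⟨r.horiz 1, by have := r.preserve 0; have := r.horiz_left; simp at *; omega⟩,
    { out := fun x => r.out (x + 1)
      horiz := fun x => r.horiz (x + 1)
      horiz_left := rfl
      preserve := fun x => r.preserve (x + 1)
      horiz_right := fun x hx => r.horiz_right (x + 1) (by omega) }⟩
  invFun p :=
    { out := fun x => x.casesOn (c 0 + left - p.1) p.2.out
      horiz := fun x => x.casesOn left p.2.horiz
      horiz_left := rfl
      preserve := by
        rintro (_ | x)
        · have := p.2.horiz_left
          have := p.1.2
          change c 0 + left = c 0 + left - p.1 + p.2.horiz 0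
          omega
        · exact p.2.preserve x
      horiz_right := by
        rintro (_ | x) hx
        · omega
        · exact p.2.horiz_right x (by omega) }
  left_inv r := by
    have h1 := r.preserve 0
    have h2 := r.horiz_left
    rw [zero_add] at h1
    ext x
    · rcases x with _ | x
      · change c 0 + left - r.horiz 1 = r.out 0
        omega
      · rfl
    · rcases x with _ | x
      · exact h2.symm
      · rfl
  right_inv := by
    rintro ⟨⟨j, hj⟩, ⟨out, horiz, h1, h2, h3⟩⟩
    simp only at h1
    subst h1
    rfl

instance Row.instFinite (L : ℕ) : ∀ (left : ℕ) (c : ℕ → ℕ), Finite (Row L left c) := by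
  induction L with
  | zero =>
    intro left c
    have : Subsingleton (Row 0 left c) := by
      refine ⟨fun r t => ?_⟩
      have hr := fun x => r.horiz_right x (Nat.zero_le x)
      have ht := fun x => t.horiz_right x (Nat.zero_le x)
      ext x
      · have h1 := r.preserve x
        have h2 := t.preserve x
        rw [hr, hr] at h1
        rw [ht, ht] at h2
        omega
      · rw [hr, ht]
    infer_instance
  | succ L ih => exact fun left c => Finite.of_equiv _ (Row.consEquiv L left c).symm

instance Row.instFintype (L left : ℕ) (c : ℕ → ℕ) : Fintype (Row L left c) := Fintype.ofFinite _

/-- The weight of a row. -/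
def Row.weight (q s u : ℂ) {L left : ℕ} {c : ℕ → ℕ} (r : Row L left c) : ℂ :=
  ∏ x ∈ Finset.range L, vertexWeight q s u (c x) (r.horiz x) (r.out x) (r.horiz (x + 1))

theorem vertexWeight_eq_zero_of_two_le (q s u : ℂ) (a j b j' : ℕ) (h : 2 ≤ j') :
    vertexWeight q s u a j b j' = 0 := by
  obtain ⟨j', rfl⟩ := Nat.exists_eq_add_of_le' h
  rcases j with _ | _ | j <;> rfl

/-- The row operators sum over all rows. -/
theorem sum_row_weight (q s u : ℂ) (L : ℕ) : ∀ (left : ℕ) (c : ℕ → ℕ), (∀ x, L ≤ x → c x = 0) →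
    ∀ φ, ∑ r : Row L left c, r.weight q s u * φ (configList L r.out) =
      rowOp q s u left φ (configList L c) := by
  induction L with
  | zero =>
    intro left c hc φ
    by_cases hleft : left = 0
    · subst hleft
      let r₀ : Row 0 0 c := ⟨fun _ => 0, fun _ => 0, rfl, fun x => by rw [hc x (Nat.zero_le x)],
        fun _ _ => rfl⟩
      rw [Fintype.sum_eq_single r₀]
      · simp [Row.weight, configList, rowOp]
      · intro r hr
        refine absurd ?_ hr
        have h0 := fun x => r.horiz_right x (Nat.zero_le x)
        ext x
        · have h1 := r.preserve x
          rw [h0, h0, hc x (Nat.zero_le x)] at h1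
          exact h1.symm
        · exact h0 x
    · have : IsEmpty (Row 0 left c) := ⟨fun r => hleft (by
        rw [← r.horiz_left, r.horiz_right 0 le_rfl])⟩
      simp [configList, rowOp, hleft]
  | succ L ih =>
    intro left c hc φ
    have hc' : ∀ x, L ≤ x → c (x + 1) = 0 := fun x hx => hc _ (by omega)
    rw [configList_succ, ← Equiv.sum_comp (Row.consEquiv L left c).symm, Fintype.sum_sigma, rowOp]
    have hterm : ∀ j : Fin (c 0 + left + 1), ∑ r : Row L j fun x => c (x + 1),
        ((Row.consEquiv L left c).symm ⟨j, r⟩).weight q s u *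
          φ (configList (L + 1) ((Row.consEquiv L left c).symm ⟨j, r⟩).out) =
        vertexWeight q s u (c 0) left (c 0 + left - j) j *
          rowOp q s u j (slice φ (c 0 + left - j)) (configList L fun x => c (x + 1)) := by
      intro j
      rw [← ih j _ hc', Finset.mul_sum]
      refine Finset.sum_congr rfl fun r _ => ?_
      have h0 := r.horiz_left
      rw [Row.weight, Finset.prod_range_succ', configList_succ, Row.weight]
      change (∏ x ∈ Finset.range L,
        vertexWeight q s u (c (x + 1)) (r.horiz x) (r.out x) (r.horiz (x + 1))) *
        vertexWeight q s u (c 0) left (c 0 + left - j) (r.horiz 0) *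
        φ ((c 0 + left - j) :: configList L r.out) = _
      rw [h0, slice]
      ring
    rw [Finset.sum_congr rfl fun j _ => hterm j, ← Finset.sum_range fun j =>
      vertexWeight q s u (c 0) left (c 0 + left - j) j *
          rowOp q s u j (slice φ (c 0 + left - j)) (configList L fun x => c (x + 1))]
    trans ∑ j ∈ Finset.range (c 0 + left + 2), vertexWeight q s u (c 0) left (c 0 + left - j) j *
          rowOp q s u j (slice φ (c 0 + left - j)) (configList L fun x => c (x + 1))
    · rw [Finset.sum_range_succ _ (c 0 + left + 1), eq_comm, add_eq_left]
      -- Without any arrow entering, an arrow leaving to the right has weight zero.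
      rcases Nat.eq_zero_or_pos (c 0 + left) with h0 | h0
      · obtain ⟨h1, h2⟩ := Nat.add_eq_zero_iff.1 h0
        rw [h1, h2]
        simp [vertexWeight]
      · rw [vertexWeight_eq_zero_of_two_le _ _ _ _ _ _ _ (by omega), zero_mul]
    · refine (Finset.sum_subset (Finset.range_mono (by omega)) fun j _ hj => ?_).symm
      rw [vertexWeight_eq_zero_of_two_le _ _ _ _ _ _ _ (by
        have := Finset.mem_range.not.1 hj
        omega), zero_mul]

/-- Collections of up-right paths in `n` rows of the columns `0, …, L - 1`, for arbitrary
configurations `c` below and `d` above the rows. -/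
@[ext]
structure BoundedPaths (left L : ℕ) (c d : ℕ → ℕ) (n : ℕ) where
  vert : Fin (n + 1) → ℕ → ℕ
  horiz : Fin n → ℕ → ℕ
  vert_bottom : vert 0 = c
  vert_top : vert (Fin.last n) = d
  horiz_left : ∀ y, horiz y 0 = left
  preserve : ∀ y x, vert y.castSucc x + horiz y x = vert y.succ x + horiz y (x + 1)
  horiz_right : ∀ y x, L ≤ x → horiz y x = 0

/-- A path collection is its lowest row together with the other rows. -/
def BoundedPaths.consEquiv (left L : ℕ) (c d : ℕ → ℕ) (n : ℕ) :
    BoundedPaths left L c d (n + 1) ≃ Σ r : Row L left c, BoundedPaths left L r.out d n where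
  toFun P := ⟨⟨P.vert (Fin.succ 0), P.horiz 0, P.horiz_left 0,
      fun x => by rw [← P.preserve 0 x, Fin.castSucc_zero, P.vert_bottom], P.horiz_right 0⟩,
    { vert := fun y => P.vert y.succ
      horiz := fun y => P.horiz y.succ
      vert_bottom := rfl
      vert_top := P.vert_top
      horiz_left := fun y => P.horiz_left y.succ
      preserve := fun y => P.preserve y.succ
      horiz_right := fun y => P.horiz_right y.succ }⟩
  invFun p :=
    { vert := Fin.cons c p.2.vert
      horiz := Fin.cons p.1.horiz p.2.horiz
      vert_bottom := rfl
      vert_top := p.2.vert_top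
      horiz_left := Fin.cases p.1.horiz_left p.2.horiz_left
      preserve := by
        refine Fin.cases ?_ fun y => ?_
        · intro x
          have := congrFun p.2.vert_bottom x
          simp only [Fin.castSucc_zero, Fin.cons_zero, Fin.cons_succ, this]
          exact p.1.preserve x
        · exact p.2.preserve y
      horiz_right := Fin.cases p.1.horiz_right p.2.horiz_right }
  left_inv P := by
    ext y x
    · refine Fin.cases ?_ (fun y => ?_) y
      · exact congrFun P.vert_bottom.symm x
      · rfl
    · refine Fin.cases ?_ (fun y => ?_) y <;> rfl
  right_inv := by
    rintro ⟨⟨out, horiz, h1, h2, h3⟩, ⟨vert, horiz', h4, h5, h6, h7, h8⟩⟩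
    simp only at h4
    subst h4
    rfl

instance BoundedPaths.instFinite (left L n : ℕ) :
    ∀ c d : ℕ → ℕ, Finite (BoundedPaths left L c d n) := by
  induction n with
  | zero =>
    intro c d
    have : Subsingleton (BoundedPaths left L c d 0) := by
      refine ⟨fun P Q => ?_⟩
      ext y x
      · rw [Fin.fin_one_eq_zero y, P.vert_bottom, Q.vert_bottom]
      · exact y.elim0
    infer_instance
  | succ n ih => exact fun c d => Finite.of_equiv _ (BoundedPaths.consEquiv left L c d n).symm

instance BoundedPaths.instFintype (left L : ℕ) (c d : ℕ → ℕ) (n : ℕ) :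
    Fintype (BoundedPaths left L c d n) := Fintype.ofFinite _

/-- The weight of a path collection. -/
def BoundedPaths.weight (q s : ℂ) {left L n : ℕ} {c d : ℕ → ℕ} (u : Fin n → ℂ)
    (P : BoundedPaths left L c d n) : ℂ :=
  ∏ y : Fin n, ∏ x ∈ Finset.range L, vertexWeight q s (u y)
    (P.vert y.castSucc x) (P.horiz y x) (P.vert y.succ x) (P.horiz y (x + 1))

theorem Row.out_eq_zero {L left : ℕ} {c : ℕ → ℕ} (r : Row L left c) {x : ℕ} (hx : L ≤ x)
    (hc : c x = 0) : r.out x = 0 := by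
  have h1 := r.preserve x
  rw [hc, r.horiz_right x hx, r.horiz_right (x + 1) (by omega)] at h1
  exact h1.symm

theorem sum_boundedPaths_weight (q s : ℂ) (left L : ℕ) (d : ℕ → ℕ) (hd : ∀ x, L ≤ x → d x = 0)
    (n : ℕ) : ∀ (c : ℕ → ℕ), (∀ x, L ≤ x → c x = 0) → ∀ u : Fin n → ℂ,
    ∑ P : BoundedPaths left L c d n, P.weight q s u =
      (List.ofFn u).foldr (fun w ψ => rowOp q s w left ψ) (pointMass (configList L d))
        (configList L c) := by
  induction n with
  | zero =>
    intro c hc u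
    rw [List.ofFn_zero, List.foldr_nil, pointMass]
    split_ifs with h
    · have hcd : c = d := by
        funext x
        rcases Nat.lt_or_ge x L with hx | hx
        · exact congrFun (List.ofFn_injective h) ⟨x, hx⟩
        · rw [hc x hx, hd x hx]
      subst hcd
      let P₀ : BoundedPaths left L c c 0 := ⟨fun _ => c, fun y => y.elim0, rfl, rfl,
        fun y => y.elim0, fun y => y.elim0, fun y => y.elim0⟩
      rw [Fintype.sum_eq_single P₀]
      · simp [BoundedPaths.weight]
      · intro P hP
        refine absurd ?_ hP
        ext y x
        · rw [Fin.fin_one_eq_zero y, P.vert_bottom]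
        · exact y.elim0
    · have : IsEmpty (BoundedPaths left L c d 0) := ⟨fun P =>
        h (congrArg (configList L) (P.vert_bottom.symm.trans P.vert_top))⟩
      simp
  | succ n ih =>
    intro c hc u
    rw [← Equiv.sum_comp (BoundedPaths.consEquiv left L c d n).symm, Fintype.sum_sigma,
      List.ofFn_succ, List.foldr_cons, ← sum_row_weight q s (u 0) L left c hc]
    refine Finset.sum_congr rfl fun r _ => ?_
    rw [← ih r.out (fun x hx => r.out_eq_zero hx (hc x hx)), Finset.mul_sum]
    refine Finset.sum_congr rfl fun P _ => ?_
    rw [BoundedPaths.weight, Fin.prod_univ_succ, Row.weight, BoundedPaths.weight]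
    have h0 := P.vert_bottom
    simp only [BoundedPaths.consEquiv, Equiv.coe_fn_symm_mk, Fin.castSucc_zero, Fin.cons_zero,
      Fin.cons_succ, h0, Fin.castSucc_succ]

theorem mult_eq_zero {N : ℕ} (lam : Fin N → ℕ) {x : ℕ} (h : ∀ i, lam i ≠ x) :
    mult lam x = 0 := by
  rw [mult, Finset.card_eq_zero, Finset.filter_eq_empty_iff]
  exact fun i _ => h i

/-- Path collections stay within the columns in which they end. -/
def PathCollection.equivBoundedPaths {left N m n L : ℕ} {lam : Fin N → ℕ} {mu : Fin m → ℕ}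
    (hL : ∀ i, mu i ≤ L) :
    PathCollection left lam mu n ≃ BoundedPaths left (L + 1) (mult lam) (mult mu) n where
  toFun P := ⟨P.vert, P.horiz, funext P.vert_bottom, funext P.vert_top, P.horiz_left, P.preserve,
    fun y _ hx => (P.eq_zero_of_lt hL hx).2 y⟩
  invFun P := ⟨P.vert, P.horiz, congrFun P.vert_bottom, congrFun P.vert_top, P.horiz_left,
    P.preserve, fun y => ⟨L + 1, P.horiz_right y⟩⟩
  left_inv _ := rfl
  right_inv _ := rfl

theorem sum_pathCollection_weight (q s : ℂ) {left N m n L : ℕ} (lam : Fin N → ℕ) {mu : Fin m → ℕ}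
    (hL : ∀ i, mu i ≤ L) {u : Fin n → ℂ} (hu : ∀ y, 1 - s * u y ≠ 0) :
    ∑ᶠ P : PathCollection left lam mu n, P.weight q s u =
      ∑ P : BoundedPaths left (L + 1) (mult lam) (mult mu) n, P.weight q s u := by
  rw [← finsum_eq_sum_of_fintype]
  refine finsum_eq_of_bijective _ (PathCollection.equivBoundedPaths hL).bijective fun P => ?_
  refine Finset.prod_congr rfl fun y _ => ?_
  refine finprod_eq_prod_of_mulSupport_subset _ fun x hx => ?_
  by_contra hxL
  refine hx ?_
  have hx' : L < x := by simpa using hxL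
  have h1 := P.eq_zero_of_lt hL hx'
  have h2 := P.eq_zero_of_lt hL (Nat.lt_succ_of_lt hx')
  simp only [h1.1, h1.2, h2.2, vertexWeight, if_true, pow_zero, mul_one]
  exact div_self (hu y)

theorem sum_pathCollection_weight_eq_rowProd (q s : ℂ) {left N m n L : ℕ} {lam : Fin N → ℕ}
    {mu : Fin m → ℕ} (hlam : ∀ i, lam i ≤ L) (hL : ∀ i, mu i ≤ L) {u : Fin n → ℂ}
    (hu : ∀ y, 1 - s * u y ≠ 0) :
    ∑ᶠ P : PathCollection left lam mu n, P.weight q s u =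
      rowProd q s u left Finset.univ (pointMass (configList (L + 1) (mult mu)))
        (configList (L + 1) (mult lam)) := by
  rw [sum_pathCollection_weight q s lam hL hu, sum_boundedPaths_weight, rowProd,
    Fin.univ_val_map, Multiset.coe_foldr]
  · exact fun x hx => mult_eq_zero _ fun i h => by have := hL i; omega
  · exact fun x hx => mult_eq_zero _ fun i h => by have := hlam i; omega

/-! ### Continuity -/

theorem eventually_one_sub_mul_ne_zero (s : ℂ) {N : ℕ} {u : Fin N → ℂ}
    (hu : ∀ i, 1 - s * u i ≠ 0) : ∀ᶠ w in 𝓝 u, ∀ i, 1 - s * w i ≠ 0 := by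
  refine eventually_all.2 fun i => ?_
  have hc : ContinuousAt (fun w : Fin N → ℂ => 1 - s * w i) u :=
    (continuous_const.sub (continuous_const.mul (continuous_apply i))).continuousAt
  exact hc.eventually_ne (hu i)

theorem exists_forall_le {N : ℕ} (lam : Fin N → ℕ) : ∃ L, ∀ i, lam i ≤ L :=
  ⟨∑ i, lam i, fun i => Finset.single_le_sum (fun _ _ => Nat.zero_le _) (Finset.mem_univ i)⟩

theorem continuousAt_vertexWeight (q s : ℂ) (a j b j' : ℕ) {u : ℂ} (hu : 1 - s * u ≠ 0) :
    ContinuousAt (fun w => vertexWeight q s w a j b j') u := by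
  rcases j with _ | _ | j <;> rcases j' with _ | _ | j' <;> simp only [vertexWeight] <;>
    first
    | exact continuousAt_const
    | (split_ifs
       · fun_prop (disch := assumption)
       · exact continuousAt_const)

theorem continuousAt_sum_pathCollection_weight (q s : ℂ) {left N m n : ℕ} (lam : Fin N → ℕ)
    (mu : Fin m → ℕ) {u : Fin n → ℂ} (hu : ∀ y, 1 - s * u y ≠ 0) :
    ContinuousAt (fun w => ∑ᶠ P : PathCollection left lam mu n, P.weight q s w) u := by
  obtain ⟨L, hL⟩ := exists_forall_le mu
  have hcont : ContinuousAt (fun w : Fin n → ℂ =>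
      ∑ P : BoundedPaths left (L + 1) (mult lam) (mult mu) n, P.weight q s w) u := by
    refine tendsto_finsetSum _ fun P _ => tendsto_finsetProd _ fun y _ =>
      tendsto_finsetProd _ fun x _ => ?_
    exact (continuousAt_vertexWeight q s _ _ _ _ (hu y)).comp
      (f := fun w : Fin n → ℂ => w y) (continuous_apply y).continuousAt
  refine hcont.congr ?_
  filter_upwards [eventually_one_sub_mul_ne_zero s hu] with w hw
  exact (sum_pathCollection_weight q s lam hL hw).symm

/-! ### Final positions as decreasing sequences -/

theorem pairwise_positions (d : List ℕ) : (positions d).Pairwise (· ≥ ·) := by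
  induction d with
  | nil => exact List.Pairwise.nil
  | cons m d ih =>
    refine List.pairwise_append.2 ⟨?_, ?_, ?_⟩
    · exact ih.map _ fun a b h => Nat.succ_le_succ h
    · exact List.pairwise_replicate.2 (Or.inr le_rfl)
    · intro a _ b hb
      rw [List.eq_of_mem_replicate hb]
      exact Nat.zero_le a

theorem count_positions (d : List ℕ) : ∀ x, (positions d).count x = d.getD x 0 := by
  induction d with
  | nil => intro x; simp [positions]
  | cons m d ih =>
    rintro (_ | x)
    · rw [positions, List.count_append, List.count_replicate_self,
        List.count_eq_zero_of_not_mem (by simp)]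
      simp
    · rw [positions, List.count_append, List.count_map_of_injective _ _ Nat.succ_injective, ih]
      simp [List.count_replicate]

theorem count_ofFn {N : ℕ} (lam : Fin N → ℕ) (x : ℕ) : (List.ofFn lam).count x = mult lam x := by
  rw [← Multiset.coe_count, ← Fin.univ_val_map, Multiset.count_map, mult, Finset.card_def,
    Finset.filter_val]
  simp only [eq_comm]

theorem positions_configList {N L : ℕ} {lam : Fin N → ℕ} (hlam : Antitone lam)
    (hL : ∀ i, lam i ≤ L) : positions (configList (L + 1) (mult lam)) = List.ofFn lam := by
  refine List.Perm.eq_of_pairwise (le := (· ≥ ·)) (fun a b _ _ h1 h2 => le_antisymm h2 h1)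
    (pairwise_positions _) (List.pairwise_ofFn.2 fun i j h => hlam h.le)
    (List.perm_iff_count.2 fun x => ?_)
  rw [count_positions, count_ofFn, configList]
  rcases Nat.lt_or_ge x (L + 1) with hx | hx
  · rw [List.getD_eq_getElem _ _ (by simpa using hx), List.getElem_ofFn]
  · rw [List.getD_eq_default _ _ (by simpa using hx),
      mult_eq_zero _ fun i h => by have := hL i; omega]

theorem length_configList (L : ℕ) (c : ℕ → ℕ) : (configList L c).length = L := List.length_ofFn

theorem configList_eq_replicate (L : ℕ) {c : ℕ → ℕ} (hc : ∀ x, c x = 0) :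
    configList L c = List.replicate L 0 := by
  simp [configList, hc, List.ofFn_const]

/-! ### The symmetrization formulas -/

theorem symmetrize_eq_crossSum (q : ℂ) {N : ℕ} (Φ : Fin N → ℂ → ℂ) (u : Fin N → ℂ) :
    symmetrize (fun w => crossTerm q w * ∏ i, Φ i (w i)) u =
      crossSum q u (List.ofFn Φ) Finset.univ := by
  have h := sum_perm_crossTerm q u N Φ (Function.Embedding.refl _)
  rwa [Finset.map_refl] at h

theorem F_eq_symmF (q s : ℂ) {M : ℕ} {μ : Fin M → ℕ} (hμ : Antitone μ) {u : Fin M → ℂ}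
    (hu : ∀ i, 1 - s * u i ≠ 0) (hinj : Function.Injective u) : F q s μ u = symmF q s μ u := by
  obtain ⟨L, hL⟩ := exists_forall_le μ
  have h := rowProd_one_pointMass q s hinj hu (configList (L + 1) (mult μ)) Finset.univ
  rw [positions_configList hμ hL, length_configList, List.map_ofFn] at h
  rw [F, skewF, sum_pathCollection_weight_eq_rowProd q s (fun i => i.elim0) hL hu,
    configList_eq_replicate _ (fun x => mult_eq_zero _ fun i => i.elim0), h, symmF,
    symmetrize_eq_crossSum q (fun i w => ((w - s) / (1 - s * w)) ^ μ i), Finset.card_univ,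
    Fintype.card_fin, Finset.prod_inv_distrib, div_eq_mul_inv]
  rfl

theorem G_eq_rowProd (q s : ℂ) {n N L : ℕ} {ν : Fin n → ℕ} (hL : ∀ i, ν i ≤ L) {v : Fin N → ℂ}
    (hv : ∀ j, 1 - s * v j ≠ 0) :
    G q s ν v = rowProd q s v 0 Finset.univ
      (pointMass (mult ν 0 :: configList L fun x => mult ν (x + 1))) (n :: List.replicate L 0) := by
  rw [G, skewG, sum_pathCollection_weight_eq_rowProd q s (fun _ => Nat.zero_le L) hL hv,
    configList_succ, configList_succ, configList_eq_replicate L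
      (c := fun x => mult (fun _ : Fin n => 0) (x + 1)) fun x => mult_eq_zero _ fun _ => by simp]
  simp [mult]

theorem G_eq_symmG (q s : ℂ) {n N : ℕ} {ν : Fin n → ℕ} (hν : Antitone ν) {v : Fin N → ℂ}
    (hv : ∀ j, 1 - s * v j ≠ 0) (hN : n - mult ν 0 ≤ N)
    (hq : qPoch q q (N - (n - mult ν 0)) ≠ 0) (hs : qPoch (s ^ 2) q (mult ν 0) ≠ 0)
    (hinj : Function.Injective v) (hvs : ∀ j, v j ≠ s) :
    G q s ν v = symmG q s ν (mult ν 0) v := by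
  obtain ⟨L, hL⟩ := exists_forall_le ν
  have hpos := positions_configList hν hL
  rw [configList_succ, positions] at hpos
  rw [G_eq_rowProd q s hL hv]
  generalize hd : (configList L fun x => mult ν (x + 1)) = d at hpos ⊢
  have hdL : d.length = L := by rw [← hd, length_configList]
  have hlen : (positions d).length + mult ν 0 = n := by
    simpa using congrArg List.length hpos
  have hmain := rowProd_zero_pointMass q s hinj hv (mult ν 0) (n - mult ν 0) d Finset.univ
    (by simpa using hN) (fun m w => ((w - s) / (1 - s * w)) ^ (m + 1) * (w / (w - s))) (by
      intro m j
      have h1 := sub_ne_zero.2 (hvs j)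
      have h2 := hv j
      rw [pow_succ]
      field_simp)
  have hlist : ((positions d).map fun m w => ((w - s) / (1 - s * w)) ^ (m + 1) * (w / (w - s))) ++
      List.replicate (N - (n - mult ν 0)) (fun w => 1 - s * q ^ mult ν 0 * w) =
      List.ofFn fun (j : Fin N) (w : ℂ) => if h : j.val < n - mult ν 0 then
          ((w - s) / (1 - s * w)) ^ ν ⟨j.val, lt_of_lt_of_le h (Nat.sub_le n (mult ν 0))⟩ *
            (w / (w - s))
        else 1 - s * q ^ mult ν 0 * w := by
    refine List.ext_getElem (by simp; omega) fun i h1 h2 => ?_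
    rw [List.getElem_ofFn]
    funext w
    by_cases hi : i < n - mult ν 0
    · have hi' : i < (positions d).length := by omega
      have hν' : ν ⟨i, by omega⟩ = (positions d)[i] + 1 := by
        have h3 : (List.ofFn ν)[i]'(by rw [List.length_ofFn]; omega) = ν ⟨i, by omega⟩ :=
          List.getElem_ofFn _
        rw [← h3]
        simp only [← hpos]
        rw [List.getElem_append_left (by simpa using hi'), List.getElem_map]
      rw [dif_pos hi, List.getElem_append_left (by simpa using hi'), List.getElem_map, hν']
    · rw [dif_neg hi, List.getElem_append_right (by simp; omega), List.getElem_replicate]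
  rw [Finset.card_univ, Fintype.card_fin, hlist, hdL, Nat.add_sub_cancel' (by omega),
    Finset.prod_inv_distrib] at hmain
  rw [symmG, symmetrize_eq_crossSum q (fun (j : Fin N) (w : ℂ) => if h : j.val < n - mult ν 0 then
          ((w - s) / (1 - s * w)) ^ ν ⟨j.val, lt_of_lt_of_le h (Nat.sub_le n (mult ν 0))⟩ *
            (w / (w - s))
        else 1 - s * q ^ mult ν 0 * w), div_mul_eq_mul_div, div_mul_eq_mul_div,
    eq_div_iff (mul_ne_zero hq hs), div_eq_mul_inv]
  linear_combination hmain

theorem G_eq_zero (q s : ℂ) {n N : ℕ} (ν : Fin n → ℕ) {v : Fin N → ℂ}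
    (hv : ∀ j, 1 - s * v j ≠ 0) (hN : N < n - mult ν 0) : G q s ν v = 0 := by
  obtain ⟨L, hL⟩ := exists_forall_le ν
  rw [G_eq_rowProd q s hL hv]
  refine rowProd_zero_eq_zero q s v n _ _ _ fun b hb => ?_
  rw [Finset.card_univ, Fintype.card_fin] at hb
  rw [slice_pointMass, if_neg (by omega)]

end HigherSpin
end

theorem theorem4p12 (q s : ℂ) :
    (∀ (M : ℕ) (μ : Fin M → ℕ), Antitone μ →
      ∀ u : Fin M → ℂ, (∀ i, 1 - s * u i ≠ 0) →
        (Function.Injective u → HigherSpin.F q s μ u = HigherSpin.symmF q s μ u) ∧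
        Tendsto (HigherSpin.symmF q s μ) (𝓝[{w | Function.Injective w}] u)
          (𝓝 (HigherSpin.F q s μ u))) ∧
    (∀ (n : ℕ) (ν : Fin n → ℕ), Antitone ν →
      ∀ k : ℕ, k = (Finset.univ.filter fun i => ν i = 0).card →
      ∀ (N : ℕ) (v : Fin N → ℂ), (∀ j, 1 - s * v j ≠ 0) →
        (n - k ≤ N →
          HigherSpin.qPoch q q (N - (n - k)) ≠ 0 → HigherSpin.qPoch (s ^ 2) q k ≠ 0 →
          (Function.Injective v → (∀ j, v j ≠ s) →
            HigherSpin.G q s ν v = HigherSpin.symmG q s ν k v) ∧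
          Tendsto (HigherSpin.symmG q s ν k)
            (𝓝[{w | Function.Injective w ∧ ∀ j, w j ≠ s}] v)
            (𝓝 (HigherSpin.G q s ν v))) ∧
        (N < n - k → HigherSpin.G q s ν v = 0)) := by
  refine ⟨fun M μ hμ u hu => ⟨HigherSpin.F_eq_symmF q s hμ hu, ?_⟩, ?_⟩
  · have hcont : ContinuousAt (HigherSpin.F q s μ) u :=
      HigherSpin.continuousAt_sum_pathCollection_weight q s _ μ hu
    refine (hcont.tendsto.mono_left nhdsWithin_le_nhds).congr' ?_
    filter_upwards [nhdsWithin_le_nhds (HigherSpin.eventually_one_sub_mul_ne_zero s hu),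
      self_mem_nhdsWithin] with w hw hinj
    exact HigherSpin.F_eq_symmF q s hμ hw hinj
  · rintro n ν hν k rfl N v hv
    refine ⟨fun hN hq hs => ⟨HigherSpin.G_eq_symmG q s hν hv hN hq hs, ?_⟩,
      HigherSpin.G_eq_zero q s ν hv⟩
    have hcont : ContinuousAt (HigherSpin.G q s ν) v :=
      HigherSpin.continuousAt_sum_pathCollection_weight q s _ ν hv
    refine (hcont.tendsto.mono_left nhdsWithin_le_nhds).congr' ?_
    filter_upwards [nhdsWithin_le_nhds (HigherSpin.eventually_one_sub_mul_ne_zero s hv),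
      self_mem_nhdsWithin] with w hw hinj
    exact HigherSpin.G_eq_symmG q s hν hw hN hq hs hinj.1 hinj.2
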